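/- Let $E$ be a finite-dimensional affine space over $\mathbb C$ whose space of translations $V$ carries a Hermitian (positive definite) inner product $\langle\cdot\mid\cdot\rangle$, and let $A(E)$ be the group of its affine transformations. An *affine reflection* is a distance-preserving $\gamma\in A(E)$ of finite order whose fixed point set has codimension $1$. A subgroup $W\subseteq A(E)$ is an *$r$-group* if it is discrete and generated by affine reflections. Subgroups $W\subseteq A(E)$ and $W'\subseteq A(E')$ are *equivalent* if $W'=\phi W\phi^{-1}$ for some (not necessarily isometric) affine bijection $\phi\colon E\to E'$. A group $W$ is *irreducible* if it is not equivalent to a product $W_1\times\dots\times W_m\subseteq A(E_1\times\dots\times E_m)$ with $m\ge 2$, $W_j\subseteq A(E_j)$ and all $E_j$ of positive dimension. $W$ is *noncrystallographic* if the orbit space $E/W$ is not compact. A *real form* of $E$ is a real affine subspace $E_{\mathbb R}=a+V_{\mathbb R}$, where $a\in E$ and $V_{\mathbb R}\subseteq V$ is a real linear subspace such that $V_{\mathbb R}\otimes_{\mathbb R}\mathbb C\to V$ is an isomorphism and $\langle\cdot\mid\cdot\rangle$ is real-valued on $V_{\mathbb R}$. Every motion $\gamma$ of the Euclidean affine space $E_{\mathbb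 R}$ extends uniquely to a motion $\gamma_{\mathbb C}\in A(E)$; the *complexification* of a group $G$ of motions of $E_{\mathbb R}$ is $G_{\mathbb C}=\{\gamma_{\mathbb C}\mid\gamma\in G\}$. An *irreducible affine Weyl group* on $E_{\mathbb R}$ is a group generated by all the affine reflections $x\mapsto x-(\langle\alpha\mid x-o\rangle-k)\,\alpha^\vee$, where $\alpha\in R$, $k\in\mathbb Z$, $\alpha^\vee=2\alpha/\langle\alpha\mid\alpha\rangle$, $o\in E_{\mathbb R}$ is a point and $R$ is an irreducible (reduced, crystallographic) root system in $V_{\mathbb R}$ with orthogonal root reflections. **Theorem.** Let $W\subseteq A(E)$ be an infinite irreducible $r$-group. Then $W$ is noncrystallographic if and only if it is equivalent to the complexification of an irreducible affine Weyl group acting on a real form of $E$. -/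

import Mathlib

open scoped InnerProductSpace

-- The real part of the Hermitian product makes a Hermitian space a real Euclidean space (and,
-- by restriction, every real subspace of it).
attribute [local instance] InnerProductSpace.complexToReal

namespace ReflGroup

section Affine

variable {𝕜 : Type*} [RCLike 𝕜]
  {V : Type*} [NormedAddCommGroup V] [InnerProductSpace 𝕜 V]
  {E : Type*} [MetricSpace E] [NormedAddTorsor V E]

/-- The fixed point set `H_γ` of an affine transformation `γ`, an affine subspace of `E`. -/
def fixedSubspace (γ : E ≃ᵃ[𝕜] E) : AffineSubspace 𝕜 E where
  carrier := {x | γ x = x}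
  smul_vsub_vadd_mem' := by
    intro c p₁ p₂ p₃ h₁ h₂ h₃
    have h := γ.toAffineMap.linearMap_vsub p₁ p₂
    change γ.linear (p₁ -ᵥ p₂) = γ p₁ -ᵥ γ p₂ at h
    change γ p₁ = p₁ at h₁
    change γ p₂ = p₂ at h₂
    change γ p₃ = p₃ at h₃
    change γ (c • (p₁ -ᵥ p₂) +ᵥ p₃) = c • (p₁ -ᵥ p₂) +ᵥ p₃
    rw [AffineEquiv.map_vadd, map_smul, h, h₁, h₂, h₃]

/-- An affine reflection: a motion of finite order whose fixed point set has codimension `1`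
(arbitrary finite order is allowed). -/
structure IsReflection (γ : E ≃ᵃ[𝕜] E) : Prop where
  isometry : Isometry γ
  isOfFinOrder : IsOfFinOrder γ
  nonempty : (fixedSubspace γ : Set E).Nonempty
  codim : Module.finrank 𝕜 (fixedSubspace γ).direction + 1 = Module.finrank 𝕜 V

/-- A group of affine transformations is discrete. Here `A(E)` carries the topology of pointwise
convergence; as `E` is finite-dimensional, this is the usual topology of the Lie group
`A(E) = GL(V) ⋉ V`. -/
def IsDiscreteGroup (W : Subgroup (E ≃ᵃ[𝕜] E)) : Prop :=
  DiscreteTopology ((fun (γ : E ≃ᵃ[𝕜] E) (x : E) => γ x) '' (W : Set (E ≃ᵃ[𝕜] E)))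

/-- An `r`-group: a discrete group of affine transformations generated by affine reflections. -/
structure IsRGroup (W : Subgroup (E ≃ᵃ[𝕜] E)) : Prop where
  discrete : IsDiscreteGroup W
  generated : ∃ S : Set (E ≃ᵃ[𝕜] E), (∀ γ ∈ S, IsReflection γ) ∧ W = Subgroup.closure S

/-- The equivalence relation "same `W`-orbit" on `E`. -/
def orbitSetoid (W : Subgroup (E ≃ᵃ[𝕜] E)) : Setoid E where
  r x y := ∃ γ ∈ W, γ x = y
  iseqv :=
    { refl := fun _ => ⟨1, W.one_mem, rfl⟩
      symm := by
        rintro x _ ⟨γ, hγ, rfl⟩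
        exact ⟨γ⁻¹, W.inv_mem hγ, γ.symm_apply_apply x⟩
      trans := by
        rintro x _ _ ⟨γ, hγ, rfl⟩ ⟨δ, hδ, rfl⟩
        exact ⟨δ * γ, W.mul_mem hδ hγ, rfl⟩ }

/-- `W` is noncrystallographic: the orbit space `E/W`, with the quotient topology, is not
compact. -/
def IsNoncrystallographic (W : Subgroup (E ≃ᵃ[𝕜] E)) : Prop :=
  ¬ CompactSpace (Quotient (orbitSetoid W))

end Affine

section Equivalence

variable {𝕜 : Type*} [Field 𝕜]

/-- `W ⊆ A(E)` and `W' ⊆ A(E')` are equivalent: `W' = φ W φ⁻¹` for an affine bijection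
`φ : E → E'`, not necessarily isometric. -/
def Equivalent
    {V E V' E' : Type*} [AddCommGroup V] [Module 𝕜 V] [AddTorsor V E]
    [AddCommGroup V'] [Module 𝕜 V'] [AddTorsor V' E']
    (W : Subgroup (E ≃ᵃ[𝕜] E)) (W' : Subgroup (E' ≃ᵃ[𝕜] E')) : Prop :=
  ∃ φ : E ≃ᵃ[𝕜] E',
    (W' : Set (E' ≃ᵃ[𝕜] E')) = (fun γ => (φ.symm.trans γ).trans φ) '' (W : Set (E ≃ᵃ[𝕜] E))

/-- The product `W₁ × ⋯ × W_m ⊆ A(E₁ × ⋯ × E_m)`, acting factor by factor. -/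
def prodGroup {ι : Type*} {V E : ι → Type*} [∀ j, AddCommGroup (V j)] [∀ j, Module 𝕜 (V j)]
    [∀ j, AddTorsor (V j) (E j)] (W : ∀ j, Subgroup (E j ≃ᵃ[𝕜] E j)) :
    Subgroup ((∀ j, E j) ≃ᵃ[𝕜] (∀ j, E j)) where
  carrier := {γ | ∃ δ : ∀ j, E j ≃ᵃ[𝕜] E j, (∀ j, δ j ∈ W j) ∧ ∀ x j, γ x j = δ j (x j)}
  one_mem' := ⟨fun _ => 1, fun j => (W j).one_mem, fun _ _ => rfl⟩
  mul_mem' := by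
    rintro γ γ' ⟨δ, hδ, h⟩ ⟨δ', hδ', h'⟩
    refine ⟨fun j => δ j * δ' j, fun j => (W j).mul_mem (hδ j) (hδ' j), fun x j => ?_⟩
    change γ (γ' x) j = δ j (δ' j (x j))
    rw [h, h']
  inv_mem' := by
    rintro γ ⟨δ, hδ, h⟩
    refine ⟨fun j => (δ j)⁻¹, fun j => (W j).inv_mem (hδ j), fun x j => ?_⟩
    apply (δ j).injective
    rw [← h]
    change γ (γ.symm x) j = δ j ((δ j).symm (x j))
    rw [γ.apply_symm_apply, (δ j).apply_symm_apply]

/-- `W` is irreducible: it is not equivalent to a product `W₁ × ⋯ × W_m`, `m ≥ 2`, of subgroups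
`W_j ⊆ A(E_j)` for affine spaces `E_j` of positive dimensions `d_j`. As equivalence is insensitive
to the choice of isomorphic spaces, `E_j` may be taken to be `𝕜 ^ d_j`. -/
def IsIrreducible {𝕜 V E : Type*} [RCLike 𝕜] [AddCommGroup V] [Module 𝕜 V] [AddTorsor V E]
    (W : Subgroup (E ≃ᵃ[𝕜] E)) : Prop :=
  ¬ ∃ (m : ℕ) (d : Fin m → ℕ)
      (W' : ∀ j, Subgroup (EuclideanSpace 𝕜 (Fin (d j)) ≃ᵃ[𝕜] EuclideanSpace 𝕜 (Fin (d j)))),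
      2 ≤ m ∧ (∀ j, 0 < d j) ∧ Equivalent W (prodGroup W')

end Equivalence

section Weyl

variable {U : Type*} [NormedAddCommGroup U] [InnerProductSpace ℝ U]
  {Q : Type*} [MetricSpace Q] [NormedAddTorsor U Q]

/-- `R` is a root system (reduced and crystallographic) in the Euclidean space `U`, with `U`
identified with its dual through the inner product, and all root reflections are orthogonal, i.e.
the coroot of a root `α` is `2 α / ⟪α, α⟫`. -/
structure IsEuclideanRootSystem {ι : Type*} (R : RootPairing ι ℝ U U) : Prop where
  toLinearMap_eq : R.toLinearMap = innerₗ U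
  coroot_eq : ∀ i, R.coroot i = (2 / ⟪R.root i, R.root i⟫_ℝ) • R.root i
  isRootSystem : R.IsRootSystem
  isCrystallographic : R.IsCrystallographic
  isReduced : R.IsReduced

/-- `γ` is the affine reflection `s_{α,k} : x ↦ x - (⟪α, x - o⟫ - k) α^∨`, with mirror
`⟪α, x - o⟫ = k`, where `α` is the root of index `i` of `R`, and `o` is the origin. -/
def IsAffineRootReflection {ι : Type*} (R : RootPairing ι ℝ U U) (o : Q) (i : ι) (k : ℤ)
    (γ : Q ≃ᵃ[ℝ] Q) : Prop :=
  ∀ x, γ x = -((⟪R.root i, x -ᵥ o⟫_ℝ - k) • R.coroot i) +ᵥ x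

/-- The affine Weyl group of `R` with origin `o`: the group generated by all affine reflections
`s_{α,k}`, where `α` is a root and `k` an integer. -/
def affineWeylGroup {ι : Type*} (R : RootPairing ι ℝ U U) (o : Q) : Subgroup (Q ≃ᵃ[ℝ] Q) :=
  Subgroup.closure {γ | ∃ i k, IsAffineRootReflection R o i k γ}

/-- `G` is an irreducible affine Weyl group acting on the Euclidean affine space `Q`: the affine
Weyl group of an irreducible root system. -/
def IsIrreducibleAffineWeylGroup (G : Subgroup (Q ≃ᵃ[ℝ] Q)) : Prop :=
  ∃ (ι : Type) (_ : Finite ι) (R : RootPairing ι ℝ U U) (o : Q),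
    IsEuclideanRootSystem R ∧ R.IsIrreducible ∧ G = affineWeylGroup R o

end Weyl

section Complexification

variable {V : Type*} [NormedAddCommGroup V] [InnerProductSpace ℂ V]
  {E : Type*} [MetricSpace E] [NormedAddTorsor V E]

/-- A real subspace `U` of `V` is a real form of `V`: the natural map `ℂ ⊗[ℝ] U → V` is an
isomorphism and the Hermitian product is real-valued on `U`. -/
structure IsRealForm (U : Submodule ℝ V) : Prop where
  isBaseChange : IsBaseChange ℂ U.subtype
  inner_im : ∀ x ∈ U, ∀ y ∈ U, (⟪x, y⟫_ℂ).im = 0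

/-- The complexification `{γ_ℂ ∣ γ ∈ G} ⊆ A(E)` of a group `G` of transformations of a real
affine subspace `F` of `E` (in the application, a real form of `E`): the group of the motions of
`E` that extend some element of `G`. -/
def complexification (F : AffineSubspace ℝ E) [Nonempty F] (G : Subgroup (F ≃ᵃ[ℝ] F)) :
    Subgroup (E ≃ᵃ[ℂ] E) where
  carrier := {γ' | Isometry γ' ∧ ∃ γ ∈ G, ∀ x : F, γ' x = γ x}
  one_mem' := ⟨isometry_id, 1, G.one_mem, fun _ => rfl⟩
  mul_mem' := by
    rintro γ' δ' ⟨h, γ, hγ, h₁⟩ ⟨h', δ, hδ, h₂⟩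
    refine ⟨h.comp h', γ * δ, G.mul_mem hγ hδ, fun x => ?_⟩
    change γ' (δ' x) = γ (δ x)
    rw [h₂, h₁]
  inv_mem' := by
    rintro γ' ⟨h, γ, hγ, h₁⟩
    refine ⟨h.right_inv γ'.apply_symm_apply, γ⁻¹, G.inv_mem hγ, fun x => ?_⟩
    apply γ'.injective
    rw [h₁]
    change γ' (γ'.symm x) = γ (γ.symm x)
    rw [γ'.apply_symm_apply, γ.apply_symm_apply]

end Complexification

end ReflGroup

/-! Everything rests on the translations of $W$. Irreducibility of $W$ makes its linear part
irreducible, because the root of a reflection lies either in an invariant subspace or in its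
orthogonal complement (`IsRGroup.eq_bot_or_eq_top`). An infinite discrete group of motions with
irreducible linear part contains a nonzero translation, by a Bieberbach-type commutator argument
(`IsDiscreteGroup.exists_translation_ne_zero`). Let $U$ be the real span of the translations; its
complex span is $V$.

The largest complex subspace $U\cap iU$ is invariant, so it is $0$ or $V$. If it is $V$, the
translations contain a full lattice and $E/W$ is compact. For noncrystallographic $W$, therefore,
$U$ is totally real. The root of a reflection can be taken in $U$, so its eigenvalue there is real
and the reflection has order $2$. The shortest translations along the roots, called primitive roots,
have integral Cartan numbers, form a reduced root system and make the Hermitian product real on $U$.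
The mirrors of simple reflections meet in a special point $p$ (`exists_special_point`). Relative to
$p$ the group is the complexified affine Weyl group on $p+U$ of the dual root system, the primitive
roots being its coroots. No change of coordinates is needed: equality holds, not only equivalence.

Conversely, a complexification preserves the distance to the real form. This distance descends to an
unbounded continuous function on $E/W$ (`isNoncrystallographic_of_equivalent`). -/

namespace ReflGroup

/-! ### Norm-preserving operators -/

section Unitary

variable {V : Type*} [NormedAddCommGroup V] [InnerProductSpace ℂ V]

lemma inner_map_map_of_norm {B : V →ₗ[ℂ] V} (hB : ∀ x, ‖B x‖ = ‖x‖) (x y : V) :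
    ⟪B x, B y⟫_ℂ = ⟪x, y⟫_ℂ :=
  LinearIsometry.inner_map_map ⟨B, hB⟩ x y

/-- An eigenvalue of a norm-preserving map has modulus $1$, so $\bar c$ can be moved across as $c$.
-/
lemma inner_eigenvector_map {B : V →ₗ[ℂ] V} (hB : ∀ x, ‖B x‖ = ‖x‖) {c : ℂ} {k : V}
    (hk : B k = c • k) (w : V) : ⟪k, B w⟫_ℂ = c * ⟪k, w⟫_ℂ := by
  rcases eq_or_ne k 0 with rfl | hk0
  · simp
  have hc : ‖c‖ = 1 := by
    have h := hB k
    rw [hk, norm_smul] at h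
    exact mul_right_cancel₀ (norm_ne_zero_iff.mpr hk0) (by rw [h, one_mul])
  have h := inner_map_map_of_norm hB k w
  rw [hk, inner_smul_left] at h
  rw [← h, ← mul_assoc, Complex.mul_conj, Complex.normSq_eq_norm_sq, hc]
  simp

lemma inner_eigenvector_sub {B : V →ₗ[ℂ] V} (hB : ∀ x, ‖B x‖ = ‖x‖) {c : ℂ} {k : V}
    (hk : B k = c • k) (w : V) : ⟪k, B w - c • w⟫_ℂ = 0 := by
  rw [inner_sub_right, inner_eigenvector_map hB hk, inner_smul_right, sub_self]

/-- The fixed space of a norm preserving map is orthogonal to the image of `B - 1`. -/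
lemma eq_zero_of_map_sub_fixed {B : V →ₗ[ℂ] V} (hB : ∀ x, ‖B x‖ = ‖x‖) {x : V}
    (h : B (B x - x) = B x - x) : B x = x := by
  have h1 := inner_eigenvector_sub hB (c := 1) (k := B x - x) (by rw [one_smul, h]) x
  rw [one_smul, inner_self_eq_zero] at h1
  exact sub_eq_zero.mp h1

/-- A subspace containing all eigenvectors of a norm preserving operator is everything. -/
lemma eq_top_of_eigenvectors_mem [FiniteDimensional ℂ V] {B : V →ₗ[ℂ] V}
    (hB : ∀ x, ‖B x‖ = ‖x‖) (Z : Submodule ℂ V)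
    (hZ : ∀ (c : ℂ) (v : V), B v = c • v → v ∈ Z) : Z = ⊤ := by
  let S : Submodule ℂ V := Submodule.span ℂ {v | ∃ c : ℂ, B v = c • v}
  have hSZ : S ≤ Z := Submodule.span_le.mpr fun v ⟨c, hc⟩ => hZ c v hc
  suffices hS : S = ⊤ from top_le_iff.mp (hS ▸ hSZ)
  rw [← Submodule.orthogonal_eq_bot_iff]
  have hinv : ∀ w ∈ Sᗮ, B w ∈ Sᗮ := by
    intro w hw
    rw [Submodule.mem_orthogonal] at hw ⊢
    intro u hu
    induction hu using Submodule.span_induction with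
    | mem x hx =>
      obtain ⟨c, hc⟩ := hx
      rw [inner_eigenvector_map hB hc, hw x (Submodule.subset_span ⟨c, hc⟩), mul_zero]
    | zero => simp
    | add x y _ _ hx hy => rw [inner_add_left, hx, hy, add_zero]
    | smul a x _ hx => rw [inner_smul_left, hx, mul_zero]
  by_contra hne
  have : Nontrivial Sᗮ := Submodule.nontrivial_iff_ne_bot.mpr hne
  obtain ⟨c, hc⟩ := Module.End.exists_eigenvalue (B.restrict hinv)
  obtain ⟨v, hv⟩ := hc.exists_hasEigenvector
  have hv1 : B v = c • (v : V) := by simpa using congrArg Subtype.val hv.apply_eq_smul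
  have hvS : (v : V) ∈ S := Submodule.subset_span ⟨c, hv1⟩
  have : ⟪(v : V), (v : V)⟫_ℂ = 0 := (Submodule.mem_orthogonal _ _).mp v.2 _ hvS
  exact hv.2 (Subtype.ext (inner_self_eq_zero.mp this))

/-- If `A` is unitary and close to the identity, and the unitary `B` commutes with its conjugate
`C = A B A⁻¹`, then `A` commutes with `B`. -/
lemma commute_of_commute_conj [FiniteDimensional ℂ V] {A B C : V →ₗ[ℂ] V}
    (hA : ∀ x, ‖A x‖ = ‖x‖) (hB : ∀ x, ‖B x‖ = ‖x‖)
    (hA1 : ∀ x, ‖A x - x‖ ≤ ‖x‖) (hCA : ∀ x, C (A x) = A (B x))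
    (hCB : ∀ x, C (B x) = B (C x)) (x : V) : A (B x) = B (A x) := by
  have hsurj : Function.Surjective A :=
    LinearMap.injective_iff_surjective.mp (LinearIsometry.injective ⟨A, hA⟩)
  suffices h : LinearMap.ker (A ∘ₗ B - B ∘ₗ A) = ⊤ by
    have hx : x ∈ LinearMap.ker (A ∘ₗ B - B ∘ₗ A) := h ▸ Submodule.mem_top
    exact sub_eq_zero.mp (by simpa using hx)
  refine eq_top_of_eigenvectors_mem hB _ fun c v hv => ?_
  have hw : C (A v) = c • A v := by rw [hCA, hv, map_smul]
  -- The vector $Au=(B-c)Av$ lies in the $c$-eigenspace of $C$, so $u$ lies in that of $B$, to which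
  -- the image of $B-c$ is orthogonal. Hence $u\perp Au$ and $\|Au-u\|^2=2\|u\|^2$, which forces
  -- $u=0$ as $A$ is close to the identity.
  obtain ⟨u, hu⟩ := hsurj (B (A v) - c • A v)
  have hCu : C (A u) = c • A u := by
    rw [hu, map_sub, map_smul, hCB, hw, map_smul, smul_sub]
  have hBu : B u = c • u := by
    have hinj : Function.Injective A := LinearIsometry.injective ⟨A, hA⟩
    apply hinj
    rw [← hCA, hCu, map_smul]
  have horth : ⟪u, A u⟫_ℂ = 0 := by rw [hu]; exact inner_eigenvector_sub hB hBu _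
  have hpy : ‖A u - u‖ ^ 2 = ‖u‖ ^ 2 + ‖u‖ ^ 2 := by
    rw [@norm_sub_sq ℂ, hA, inner_eq_zero_symm.mp horth]; simp
  have hu0 : u = 0 := by
    have h1 := hA1 u
    have h2 : ‖A u - u‖ ^ 2 ≤ ‖u‖ ^ 2 := by gcongr
    have h3 : ‖u‖ ^ 2 ≤ 0 := by linarith
    exact norm_eq_zero.mp (pow_eq_zero_iff two_ne_zero |>.mp (le_antisymm h3 (sq_nonneg _)))
  rw [hu0, map_zero] at hu
  simp [hv, ← sub_eq_zero.mp hu.symm]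

end Unitary

section Motion

variable {V : Type*} [NormedAddCommGroup V] [InnerProductSpace ℂ V]
  {E : Type*} [MetricSpace E] [NormedAddTorsor V E]

lemma map_vadd_linear (γ : E ≃ᵃ[ℂ] E) (v : V) (x : E) :
    γ (v +ᵥ x) = γ.linear v +ᵥ γ x := γ.map_vadd x v

lemma linear_vsub (γ : E ≃ᵃ[ℂ] E) (x y : E) : γ.linear (x -ᵥ y) = γ x -ᵥ γ y :=
  γ.toAffineMap.linearMap_vsub x y

lemma linear_mul (γ δ : E ≃ᵃ[ℂ] E) (v : V) : (γ * δ).linear v = γ.linear (δ.linear v) := rfl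

lemma linear_inv_apply (γ : E ≃ᵃ[ℂ] E) (v : V) : γ⁻¹.linear (γ.linear v) = v :=
  γ.linear.symm_apply_apply v

lemma linear_apply_inv (γ : E ≃ᵃ[ℂ] E) (v : V) : γ.linear (γ⁻¹.linear v) = v :=
  γ.linear.apply_symm_apply v

lemma inv_apply_self' (γ : E ≃ᵃ[ℂ] E) (x : E) : γ⁻¹ (γ x) = x := γ.symm_apply_apply x

lemma apply_inv_self' (γ : E ≃ᵃ[ℂ] E) (x : E) : γ (γ⁻¹ x) = x := γ.apply_symm_apply x

lemma eq_of_linear_eq_of_apply_eq {γ δ : E ≃ᵃ[ℂ] E} (h : ∀ v, γ.linear v = δ.linear v) (o : E)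
    (ho : γ o = δ o) : γ = δ := by
  ext x
  rw [← vsub_vadd x o, map_vadd_linear, map_vadd_linear, h, ho]

lemma norm_linear {γ : E ≃ᵃ[ℂ] E} (hγ : Isometry γ) (v : V) : ‖γ.linear v‖ = ‖v‖ := by
  obtain ⟨o⟩ : Nonempty E := inferInstance
  have h := hγ.dist_eq (v +ᵥ o) o
  rwa [map_vadd_linear, dist_vadd_left, dist_vadd_left] at h

lemma isometry_of_mem_closure {S : Set (E ≃ᵃ[ℂ] E)} (hS : ∀ γ ∈ S, Isometry γ) {γ : E ≃ᵃ[ℂ] E}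
    (hγ : γ ∈ Subgroup.closure S) : Isometry γ := by
  induction hγ using Subgroup.closure_induction with
  | mem x hx => exact hS x hx
  | one => exact isometry_id
  | mul x y _ _ hx hy => exact hx.comp hy
  | inv x _ hx => exact hx.right_inv x.apply_symm_apply

lemma IsRGroup.isometry {W : Subgroup (E ≃ᵃ[ℂ] E)} (hW : IsRGroup W) {γ : E ≃ᵃ[ℂ] E}
    (hγ : γ ∈ W) : Isometry γ := by
  obtain ⟨S, hS, rfl⟩ := hW.generated
  exact isometry_of_mem_closure (fun γ h => (hS γ h).isometry) hγ

lemma dist_inv_mul_apply {γ δ : E ≃ᵃ[ℂ] E} (hδ : Isometry δ) (o : E) :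
    dist ((δ⁻¹ * γ) o) o = dist (γ o) (δ o) := by
  rw [← hδ.dist_eq]
  change dist (δ (δ⁻¹ (γ o))) _ = _
  rw [apply_inv_self']

end Motion

/-! ### Discreteness and proper discontinuity -/

section Discrete

variable {V : Type*} [NormedAddCommGroup V] [InnerProductSpace ℂ V] [FiniteDimensional ℂ V]
  {E : Type*} [MetricSpace E] [NormedAddTorsor V E]

/-- The linear part of an affine transformation as a continuous linear map. -/
noncomputable def linCLM (γ : E ≃ᵃ[ℂ] E) : V →L[ℂ] V :=
  LinearMap.toContinuousLinearMap γ.linear.toLinearMap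

@[simp] lemma linCLM_apply (γ : E ≃ᵃ[ℂ] E) (v : V) : linCLM γ v = γ.linear v := rfl

lemma norm_linCLM_le {γ : E ≃ᵃ[ℂ] E} (hγ : Isometry γ) : ‖linCLM γ‖ ≤ 1 :=
  ContinuousLinearMap.opNorm_le_bound _ zero_le_one fun v => by
    rw [linCLM_apply, norm_linear hγ, one_mul]

lemma norm_linear_sub_le (γ : E ≃ᵃ[ℂ] E) (v : V) :
    ‖γ.linear v - v‖ ≤ ‖linCLM γ - 1‖ * ‖v‖ :=
  (linCLM γ - 1).le_opNorm v

lemma dist_apply_le (γ : E ≃ᵃ[ℂ] E) (o x : E) :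
    dist (γ x) x ≤ ‖linCLM γ - 1‖ * dist x o + dist (γ o) o := by
  have h1 : γ x -ᵥ x = (γ.linear (x -ᵥ o) - (x -ᵥ o)) + (γ o -ᵥ o) := by
    rw [linear_vsub, ← vsub_add_vsub_cancel (γ x) (γ o) x, ← vsub_add_vsub_cancel (γ o) o x,
      ← neg_vsub_eq_vsub_rev x o]
    abel
  rw [dist_eq_norm_vsub V, h1, dist_eq_norm_vsub V x o, dist_eq_norm_vsub V (γ o) o]
  exact (norm_add_le _ _).trans (add_le_add_left (norm_linear_sub_le γ _) _)

/-- The linear part and the displacement of one point control all displacements (`dist_apply_le`).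
Nontrivial elements with both tending to those of the identity would converge to it pointwise. -/
lemma IsDiscreteGroup.exists_pos {W : Subgroup (E ≃ᵃ[ℂ] E)} (hd : IsDiscreteGroup W) (o : E) :
    ∃ ε > 0, ∀ γ ∈ W, ‖linCLM γ - 1‖ < ε → dist (γ o) o < ε → γ = 1 := by
  by_contra! hcon
  have hpos (n : ℕ) : (0 : ℝ) < 1 / ((n : ℝ) + 1) := Nat.one_div_pos_of_nat
  choose γ hγW hγ1 hγ2 hγ3 using fun n : ℕ => hcon _ (hpos n)
  have hlim : Filter.Tendsto (fun n : ℕ => 1 / ((n : ℝ) + 1)) Filter.atTop (nhds 0) :=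
    tendsto_one_div_add_atTop_nhds_zero_nat
  have hx (x : E) : Filter.Tendsto (fun n => γ n x) Filter.atTop (nhds x) := by
    rw [tendsto_iff_dist_tendsto_zero]
    refine squeeze_zero (g := fun n : ℕ => 1 / ((n : ℝ) + 1) * dist x o + 1 / ((n : ℝ) + 1))
      (fun _ => dist_nonneg) (fun n => ?_) ?_
    · refine (dist_apply_le (γ n) o x).trans ?_
      gcongr
      · exact (hγ1 n).le
      · exact (hγ2 n).le
    · simpa using (hlim.mul_const (dist x o)).add hlim
  let S := (fun (γ : E ≃ᵃ[ℂ] E) (x : E) => γ x) '' (W : Set (E ≃ᵃ[ℂ] E))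
  have : DiscreteTopology S := hd
  let f : ℕ → S := fun n => ⟨fun x => γ n x, γ n, hγW n, rfl⟩
  let i : S := ⟨fun x => x, 1, W.one_mem, rfl⟩
  have hf : Filter.Tendsto f Filter.atTop (nhds i) := by
    rw [tendsto_subtype_rng, tendsto_pi_nhds]
    exact hx
  rw [nhds_discrete, Filter.tendsto_pure] at hf
  obtain ⟨n, hn⟩ := hf.exists
  refine hγ3 n ?_
  ext x
  exact congrFun (congrArg Subtype.val hn) x

/-- Finitely many balls of radius $\varepsilon/2$ cover the image, and each contains at most one of
the points. -/
lemma finite_of_bounded_of_separated {X ι : Type*} [PseudoMetricSpace X] [ProperSpace X]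
    (f : ι → X) (s : Set ι) (hb : Bornology.IsBounded (f '' s)) {ε : ℝ} (hε : 0 < ε)
    (hs : ∀ i ∈ s, ∀ j ∈ s, dist (f i) (f j) < ε → i = j) : s.Finite := by
  obtain ⟨t, ht, htc⟩ := Metric.totallyBounded_iff.mp
    (hb.isCompact_closure.totallyBounded.subset subset_closure) (ε / 2) (half_pos hε)
  refine (ht.biUnion (t := fun y => {i ∈ s | f i ∈ Metric.ball y (ε / 2)}) fun y _ => ?_).subset
    fun i hi => ?_
  · refine Set.Subsingleton.finite fun i hi j hj => hs i hi.1 j hj.1 ?_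
    have h1 := Metric.mem_ball.mp hi.2
    have h2 := Metric.mem_ball.mp hj.2
    have := dist_triangle_right (f i) (f j) y
    linarith
  · obtain ⟨y, hy, hiy⟩ := Set.mem_iUnion₂.mp (htc (Set.mem_image_of_mem f hi))
    exact Set.mem_biUnion hy ⟨hi, hiy⟩

lemma norm_linCLM_inv_mul_sub_one {γ δ : E ≃ᵃ[ℂ] E} (hδ : Isometry δ) :
    ‖linCLM (δ⁻¹ * γ) - 1‖ ≤ ‖linCLM γ - linCLM δ‖ := by
  refine ContinuousLinearMap.opNorm_le_bound _ (norm_nonneg _) fun v => ?_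
  have h : (linCLM γ - linCLM δ) v = δ.linear ((linCLM (δ⁻¹ * γ) - 1) v) := by
    change γ.linear v - δ.linear v = δ.linear (δ⁻¹.linear (γ.linear v) - v)
    rw [map_sub, linear_apply_inv]
  rw [← norm_linear hδ, ← h]
  exact ContinuousLinearMap.le_opNorm _ _

/-- A discrete group of motions acts properly discontinuously. -/
lemma IsDiscreteGroup.finite_setOf_dist_le {W : Subgroup (E ≃ᵃ[ℂ] E)} (hd : IsDiscreteGroup W)
    (hiso : ∀ γ ∈ W, Isometry γ) (o : E) (R : ℝ) : {γ | γ ∈ W ∧ dist (γ o) o ≤ R}.Finite := by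
  obtain ⟨ε, hε, h⟩ := hd.exists_pos o
  have : ProperSpace (V →L[ℂ] V) := FiniteDimensional.proper ℂ _
  have : ProperSpace V := FiniteDimensional.proper ℂ _
  refine finite_of_bounded_of_separated (X := (V →L[ℂ] V) × V)
    (fun γ : E ≃ᵃ[ℂ] E => (linCLM γ, γ o -ᵥ o)) _ ?_ hε ?_
  · refine (Metric.isBounded_closedBall (x := (0 : (V →L[ℂ] V) × V)) (r := max 1 R)).subset ?_
    rintro _ ⟨γ, ⟨hγ, hR⟩, rfl⟩
    rw [mem_closedBall_zero_iff, Prod.norm_def, ← dist_eq_norm_vsub V]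
    exact max_le_max (norm_linCLM_le (hiso γ hγ)) hR
  · rintro γ ⟨hγ, -⟩ δ ⟨hδ, -⟩ hdist
    rw [Prod.dist_eq, max_lt_iff] at hdist
    have h1 := h (δ⁻¹ * γ) (W.mul_mem (W.inv_mem hδ) hγ)
      ((norm_linCLM_inv_mul_sub_one (hiso δ hδ)).trans_lt (by simpa [dist_eq_norm] using hdist.1))
      (by
        rw [dist_inv_mul_apply (hiso δ hδ), dist_eq_norm_vsub V]
        simpa [dist_eq_norm] using hdist.2)
    exact (inv_mul_eq_one.mp h1).symm

lemma IsDiscreteGroup.finite_of_fixed {W : Subgroup (E ≃ᵃ[ℂ] E)} (hd : IsDiscreteGroup W)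
    (hiso : ∀ γ ∈ W, Isometry γ) {p : E} (hp : ∀ γ ∈ W, γ p = p) : Finite W :=
  ((hd.finite_setOf_dist_le hiso p 0).subset fun γ hγ => ⟨hγ, by simp [hp γ hγ]⟩).to_subtype

end Discrete

/-! ### Commutators of motions with small linear part -/

section Commutator

variable {V : Type*} [NormedAddCommGroup V] [InnerProductSpace ℂ V]
  {E : Type*} [MetricSpace E] [NormedAddTorsor V E]

lemma commutator_apply_mul (a b : E ≃ᵃ[ℂ] E) (x : E) : (a * b * a⁻¹ * b⁻¹) (b (a x)) = a (b x) := by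
  change a (b (a⁻¹ (b⁻¹ (b (a x))))) = _
  rw [inv_apply_self', inv_apply_self']

lemma commutator_linear_mul (a b : E ≃ᵃ[ℂ] E) (v : V) :
    (a * b * a⁻¹ * b⁻¹).linear (b.linear (a.linear v)) = a.linear (b.linear v) := by
  change a.linear (b.linear (a⁻¹.linear (b⁻¹.linear (b.linear (a.linear v))))) = _
  rw [linear_inv_apply, linear_inv_apply]

variable [FiniteDimensional ℂ V]

/-- With $A,B$ the linear parts, $([A,B]-1)BA=AB-BA=(A-1)(B-1)-(B-1)(A-1)$, and $BA$ preserves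
norms. -/
lemma norm_linCLM_commutator_sub_one {a b : E ≃ᵃ[ℂ] E} (ha : Isometry a) (hb : Isometry b) :
    ‖linCLM (a * b * a⁻¹ * b⁻¹) - 1‖ ≤ 2 * ‖linCLM a - 1‖ * ‖linCLM b - 1‖ := by
  refine ContinuousLinearMap.opNorm_le_bound _ (by positivity) fun v => ?_
  obtain ⟨u, rfl⟩ : ∃ u, b.linear (a.linear u) = v :=
    ⟨a⁻¹.linear (b⁻¹.linear v), by rw [linear_apply_inv, linear_apply_inv]⟩
  have h : (linCLM (a * b * a⁻¹ * b⁻¹) - 1) (b.linear (a.linear u)) =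
      (linCLM a - 1) ((linCLM b - 1) u) - (linCLM b - 1) ((linCLM a - 1) u) := by
    change (a * b * a⁻¹ * b⁻¹).linear (b.linear (a.linear u)) - b.linear (a.linear u) =
      (a.linear (b.linear u - u) - (b.linear u - u)) - (b.linear (a.linear u - u) - (a.linear u - u))
    rw [commutator_linear_mul, map_sub, map_sub]
    abel
  rw [h, norm_linear hb, norm_linear ha]
  calc _ ≤ ‖linCLM a - 1‖ * (‖linCLM b - 1‖ * ‖u‖) + ‖linCLM b - 1‖ * (‖linCLM a - 1‖ * ‖u‖) :=
        (norm_sub_le _ _).trans (add_le_add (ContinuousLinearMap.le_opNorm_of_le _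
          (ContinuousLinearMap.le_opNorm _ _)) (ContinuousLinearMap.le_opNorm_of_le _
          (ContinuousLinearMap.le_opNorm _ _)))
    _ = _ := by ring

/-- The displacement is first estimated at $b(a(o))$, which the commutator sends to $a(b(o))$, and
then carried over to $o$. -/
lemma dist_commutator_apply_le {a b : E ≃ᵃ[ℂ] E} (hb : Isometry b) (o : E) :
    dist ((a * b * a⁻¹ * b⁻¹) o) o ≤ ‖linCLM (a * b * a⁻¹ * b⁻¹) - 1‖ * (dist (a o) o + dist (b o) o) +
      (‖linCLM a - 1‖ * dist (b o) o + ‖linCLM b - 1‖ * dist (a o) o) := by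
  refine (dist_apply_le (a * b * a⁻¹ * b⁻¹) (b (a o)) o).trans (add_le_add ?_ ?_)
  · gcongr
    rw [dist_comm]
    refine (dist_triangle _ (b o) _).trans ?_
    rw [hb.dist_eq]
  · rw [commutator_apply_mul, dist_eq_norm_vsub V, dist_eq_norm_vsub V (b o),
      dist_eq_norm_vsub V (a o)]
    have h : a (b o) -ᵥ b (a o) = (linCLM a - 1) (b o -ᵥ o) - (linCLM b - 1) (a o -ᵥ o) := by
      change _ = (a.linear (b o -ᵥ o) - (b o -ᵥ o)) - (b.linear (a o -ᵥ o) - (a o -ᵥ o))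
      rw [linear_vsub, linear_vsub, ← vsub_sub_vsub_cancel_right (a (b o)) (b (a o)) o,
        ← vsub_sub_vsub_cancel_right (a (b o)) (a o) o,
        ← vsub_sub_vsub_cancel_right (b (a o)) (b o) o]
      abel
    rw [h]
    exact (norm_sub_le _ _).trans (add_le_add (ContinuousLinearMap.le_opNorm _ _)
      (ContinuousLinearMap.le_opNorm _ _))

/-- In a discrete group of motions, elements with linear parts close to the identity have
commuting linear parts. -/
lemma IsDiscreteGroup.linear_commute {W : Subgroup (E ≃ᵃ[ℂ] E)} (hd : IsDiscreteGroup W)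
    (hiso : ∀ γ ∈ W, Isometry γ) {a b : E ≃ᵃ[ℂ] E} (ha : a ∈ W) (hb : b ∈ W)
    (ha1 : ‖linCLM a - 1‖ < 1 / 8) (hb1 : ‖linCLM b - 1‖ < 1 / 8) (v : V) :
    a.linear (b.linear v) = b.linear (a.linear v) := by
  obtain ⟨o⟩ : Nonempty E := inferInstance
  -- The iterated commutators $c_{n+1}=[c_n,b]$ contract to the identity, so discreteness gives
  -- $c_N=1$ for some $N$. Commutation of linear parts is then pulled back from $c_N$ to $c_0=a$.
  let c : ℕ → (E ≃ᵃ[ℂ] E) := fun n => Nat.rec a (fun _ x => (x * b * x⁻¹ * b⁻¹)) n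
  have hc0 : c 0 = a := rfl
  have hcs (n : ℕ) : c (n + 1) = (c n * b * (c n)⁻¹ * b⁻¹) := rfl
  have hcW (n : ℕ) : c n ∈ W := by
    induction n with
    | zero => exact ha
    | succ n ih =>
      rw [hcs]
      exact W.mul_mem (W.mul_mem (W.mul_mem ih hb) (W.inv_mem ih)) (W.inv_mem hb)
  set D := dist (b o) o with hD
  have hD0 : 0 ≤ D := dist_nonneg
  have hstep (n : ℕ) : ‖linCLM (c (n + 1)) - 1‖ ≤ ‖linCLM (c n) - 1‖ / 4 := by
    rw [hcs]
    refine (norm_linCLM_commutator_sub_one (hiso _ (hcW n)) (hiso _ hb)).trans ?_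
    nlinarith [norm_nonneg (linCLM (c n) - 1)]
  have hsmall (n : ℕ) : ‖linCLM (c n) - 1‖ ≤ 1 / 8 := by
    induction n with
    | zero => exact ha1.le
    | succ n ih => linarith [hstep n, norm_nonneg (linCLM (c n) - 1)]
  have hdist (n : ℕ) : dist (c (n + 1) o) o ≤
      dist (c n o) o / 4 + 2 * D * ‖linCLM (c n) - 1‖ := by
    have h1 := dist_commutator_apply_le (a := c n) (hiso _ hb) o
    rw [← hcs] at h1
    have h2 := hstep n
    have h3 := hsmall n
    have h4 : (0 : ℝ) ≤ dist (c n o) o := dist_nonneg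
    have h5 := mul_le_mul_of_nonneg_right (h2.trans (by linarith : _ ≤ (1 / 32 : ℝ))) h4
    have h6 := mul_le_mul_of_nonneg_right h2 hD0
    have h7 := mul_le_mul_of_nonneg_right hb1.le h4
    have h8 := mul_nonneg (norm_nonneg (linCLM (c n) - 1)) hD0
    rw [mul_add] at h1
    linarith
  -- The weight $8D+1$ absorbs the cross term $2D\|\cdot\|$ of `hdist`, so the sum at least halves
  -- at each step. The summand $1$ keeps control of the linear part when $D=0$.
  have hpot (n : ℕ) : dist (c n o) o + (8 * D + 1) * ‖linCLM (c n) - 1‖ ≤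
      (dist (a o) o + (8 * D + 1) * ‖linCLM a - 1‖) * (1 / 2) ^ n := by
    induction n with
    | zero => simp [hc0]
    | succ n ih =>
      have h1 := hdist n
      have h2 := mul_le_mul_of_nonneg_left (hstep n) (by linarith : 0 ≤ 8 * D + 1)
      have h4 : (0 : ℝ) ≤ dist (c n o) o := dist_nonneg
      have h5 := norm_nonneg (linCLM (c n) - 1)
      have h8 := mul_nonneg h5 hD0
      rw [pow_succ]
      nlinarith
  obtain ⟨ε, hε, h1⟩ := hd.exists_pos o
  have hlim : Filter.Tendsto (fun n : ℕ => (dist (a o) o + (8 * D + 1) * ‖linCLM a - 1‖) *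
      (1 / 2 : ℝ) ^ n) Filter.atTop (nhds 0) := by
    simpa using (tendsto_pow_atTop_nhds_zero_of_lt_one (r := (1 / 2 : ℝ)) (by norm_num)
      (by norm_num)).const_mul (dist (a o) o + (8 * D + 1) * ‖linCLM a - 1‖)
  obtain ⟨N, hN⟩ := (hlim.eventually_lt_const hε).exists
  have hcN : c N = 1 := by
    have h2 := (hpot N).trans_lt hN
    have h3 := norm_nonneg (linCLM (c N) - 1)
    have h4 : (0 : ℝ) ≤ dist (c N o) o := dist_nonneg
    have h5 := mul_nonneg hD0 h3
    exact h1 _ (hcW N) (by nlinarith) (by nlinarith)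
  -- Since $c_nbc_n^{-1}=c_{n+1}b$, this conjugate has linear part commuting with that of $b$ as
  -- soon as $c_{n+1}$ does, and `commute_of_commute_conj` applies.
  have hback (n : ℕ) (h : ∀ v, (c (n + 1)).linear (b.linear v) = b.linear ((c (n + 1)).linear v))
      (v : V) : (c n).linear (b.linear v) = b.linear ((c n).linear v) := by
    have hC (v : V) : (c n * b * (c n)⁻¹).linear v = (c (n + 1)).linear (b.linear v) := by
      rw [hcs]
      change _ = (c n * b * (c n)⁻¹).linear (b⁻¹.linear (b.linear v))
      rw [linear_inv_apply]
    refine commute_of_commute_conj (A := (c n).linear.toLinearMap) (B := b.linear.toLinearMap)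
      (C := (c n * b * (c n)⁻¹).linear.toLinearMap) (norm_linear (hiso _ (hcW n)))
      (norm_linear (hiso _ hb)) (fun x => ?_) (fun x => ?_) (fun x => ?_) v
    · refine (norm_linear_sub_le (c n) x).trans ?_
      nlinarith [hsmall n, norm_nonneg x]
    · change (c n).linear (b.linear ((c n)⁻¹.linear ((c n).linear x))) = _
      rw [linear_inv_apply]; rfl
    · change (c n * b * (c n)⁻¹).linear (b.linear x) = b.linear ((c n * b * (c n)⁻¹).linear x)
      rw [hC, hC, h]
  have hall (n : ℕ) : ∀ k ≤ n, n = N → ∀ v,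
      (c (n - k)).linear (b.linear v) = b.linear ((c (n - k)).linear v) := by
    intro k hk hn
    induction k with
    | zero => rw [Nat.sub_zero, hn, hcN]; intro v; rfl
    | succ k ih =>
      refine hback _ ?_
      rw [show n - (k + 1) + 1 = n - k by omega]
      exact ih (by omega)
  simpa [hc0] using hall N N le_rfl rfl v

end Commutator

/-! ### Common fixed points of commuting motions -/

section CommutingFixedPoint

variable {V : Type*} [NormedAddCommGroup V] [InnerProductSpace ℂ V] [FiniteDimensional ℂ V]
  {E : Type*} [MetricSpace E] [NormedAddTorsor V E]

/-- On an invariant subspace `D`, a norm preserving `g` gives a decomposition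
`D = ker (g - 1) + (g - 1) D`. -/
lemma exists_fixed_add_map_sub {g : V →ₗ[ℂ] V} (hg : ∀ x, ‖g x‖ = ‖x‖) {D : Submodule ℂ V}
    (hD : ∀ v ∈ D, g v ∈ D) {v : V} (hv : v ∈ D) :
    ∃ k ∈ D, g k = k ∧ ∃ d ∈ D, v = k + (g d - d) := by
  let N : D →ₗ[ℂ] D := g.restrict hD - LinearMap.id
  have hdisj : LinearMap.ker N ⊓ LinearMap.range N = ⊥ := by
    rw [eq_bot_iff]
    rintro _ ⟨hk, ⟨d, rfl⟩⟩
    have hk' : g (g d - d) = g d - d := by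
      have := congrArg Subtype.val (LinearMap.mem_ker.mp hk)
      exact sub_eq_zero.mp this
    have := eq_zero_of_map_sub_fixed hg hk'
    exact Subtype.ext (sub_eq_zero.mpr this)
  have hsup : LinearMap.ker N ⊔ LinearMap.range N = ⊤ := by
    apply Submodule.eq_top_of_finrank_eq
    have h1 := Submodule.finrank_sup_add_finrank_inf_eq (LinearMap.ker N) (LinearMap.range N)
    have h2 := LinearMap.finrank_range_add_finrank_ker N
    rw [hdisj, finrank_bot] at h1
    omega
  obtain ⟨k, hk, _, ⟨d, rfl⟩, hkd⟩ := Submodule.mem_sup.mp (hsup ▸ Submodule.mem_top (x := (⟨v, hv⟩ : D)))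
  refine ⟨k, k.2, ?_, d, d.2, ?_⟩
  · exact sub_eq_zero.mp (congrArg Subtype.val (LinearMap.mem_ker.mp hk))
  · exact (congrArg Subtype.val hkd).symm

/-- Commuting motions whose linear parts have no common nonzero fixed vector have a common fixed
point. -/
lemma exists_fixed_of_commute {A : Set (E ≃ᵃ[ℂ] E)} (hiso : ∀ γ ∈ A, Isometry γ)
    (hcomm : ∀ γ ∈ A, ∀ δ ∈ A, γ * δ = δ * γ)
    (hfix : ∀ v : V, (∀ γ ∈ A, γ.linear v = v) → v = 0) : ∃ p : E, ∀ γ ∈ A, γ p = p := by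
  obtain ⟨o⟩ : Nonempty E := inferInstance
  -- A subspace $D$ of least dimension is taken that is invariant and contains all displacements of
  -- some point $p$. Minimality will make every $\gamma$ trivial on $D$, so $D=0$ and $p$ is fixed.
  let good (n : ℕ) : Prop := ∃ (p : E) (D : Submodule ℂ V), Module.finrank ℂ D = n ∧
    ∀ γ ∈ A, (∀ v ∈ D, γ.linear v ∈ D) ∧ γ p -ᵥ p ∈ D
  have hgood : ∃ n, good n := ⟨_, o, ⊤, rfl, fun γ _ => ⟨fun _ _ => trivial, trivial⟩⟩
  classical
  obtain ⟨p, D, hn, hD⟩ := Nat.find_spec hgood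
  suffices hbot : ∀ v ∈ D, v = 0 from
    ⟨p, fun γ hγ => vsub_eq_zero_iff_eq.mp (hbot _ (hD γ hγ).2)⟩
  suffices hall : ∀ γ ∈ A, ∀ v ∈ D, γ.linear v = v from
    fun v hv => hfix v fun γ hγ => hall γ hγ v hv
  intro γ hγ
  have hγn := norm_linear (hiso γ hγ)
  obtain ⟨k, hkD, hk, d, hdD, hkd⟩ := exists_fixed_add_map_sub (g := γ.linear.toLinearMap) hγn
    (hD γ hγ).1 (hD γ hγ).2
  change γ.linear k = k at hk
  change γ p -ᵥ p = k + (γ.linear d - d) at hkd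
  let D' : Submodule ℂ V := D ⊓ LinearMap.ker (γ.linear.toLinearMap - LinearMap.id)
  have hD' (v : V) : v ∈ D' ↔ v ∈ D ∧ γ.linear v = v := by
    simp [D', sub_eq_zero]
  have hlin (δ : E ≃ᵃ[ℂ] E) (hδ : δ ∈ A) (v : V) :
      γ.linear (δ.linear v) = δ.linear (γ.linear v) := by
    rw [← linear_mul, hcomm γ hγ δ hδ, linear_mul]
  -- Moving $p$ by $-d$ removes the part of the displacement in the image of $\gamma-1$, leaving the
  -- $\gamma$-fixed vector $k$. The smaller space $D'$ is then good with base point $q$.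
  let q : E := -d +ᵥ p
  have hγq : γ q = k +ᵥ q := by
    rw [map_vadd_linear, map_neg, ← vsub_vadd (γ p) p, hkd, vadd_vadd, vadd_vadd]
    congr 1
    abel
  have hgood' : good (Module.finrank ℂ D') := by
    refine ⟨q, D', rfl, fun δ hδ => ⟨fun v hv => ?_, ?_⟩⟩
    · rw [hD'] at hv ⊢
      exact ⟨(hD δ hδ).1 v hv.1, by rw [hlin δ hδ, hv.2]⟩
    · have hx : δ q -ᵥ q ∈ D := by
        rw [map_vadd_linear, map_neg, vadd_vsub_vadd_comm]
        exact D.add_mem (D.sub_mem (D.neg_mem ((hD δ hδ).1 d hdD)) (D.neg_mem hdD)) (hD δ hδ).2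
      rw [hD']
      refine ⟨hx, ?_⟩
      -- Commutation gives $(\gamma-1)(\delta q-q)=(\delta-1)k$, a vector both fixed by $\gamma$ and
      -- in the image of $\gamma-1$, hence zero.
      have h1 : γ.linear (δ q -ᵥ q) - (δ q -ᵥ q) = δ.linear k - k := by
        have h2 : γ (δ q) = δ (γ q) := congrArg (fun f : E ≃ᵃ[ℂ] E => f q) (hcomm γ hγ δ hδ)
        rw [linear_vsub, h2, hγq, map_vadd_linear, vadd_vsub_vadd_comm, add_sub_cancel_right]
      refine eq_zero_of_map_sub_fixed (B := γ.linear.toLinearMap) hγn ?_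
      change γ.linear (γ.linear (δ q -ᵥ q) - (δ q -ᵥ q)) = γ.linear (δ q -ᵥ q) - (δ q -ᵥ q)
      rw [h1, map_sub, hlin δ hδ, hk]
  have hle : Module.finrank ℂ D ≤ Module.finrank ℂ D' := hn ▸ Nat.find_min' hgood hgood'
  have heq : D' = D := Submodule.eq_of_le_of_finrank_le inf_le_left hle
  intro v hv
  rw [← heq, hD'] at hv
  exact hv.2

end CommutingFixedPoint

/-! ### Translations and their existence -/

section Translations

variable {V : Type*} [NormedAddCommGroup V] [InnerProductSpace ℂ V]
  {E : Type*} [MetricSpace E] [NormedAddTorsor V E]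

/-- The translation vectors of a group of affine transformations. -/
def translations (W : Subgroup (E ≃ᵃ[ℂ] E)) : AddSubgroup V where
  carrier := {v | AffineEquiv.constVAdd ℂ E v ∈ W}
  zero_mem' := by
    change AffineEquiv.constVAdd ℂ E (0 : V) ∈ W
    rw [AffineEquiv.constVAdd_zero]; exact W.one_mem
  add_mem' := fun {v w} hv hw => by
    change AffineEquiv.constVAdd ℂ E (v + w) ∈ W
    rw [AffineEquiv.constVAdd_add]
    exact W.mul_mem hv hw
  neg_mem' := fun {v} hv => by
    change AffineEquiv.constVAdd ℂ E (-v) ∈ W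
    rw [← AffineEquiv.constVAdd_symm]
    exact W.inv_mem hv

lemma mem_translations {W : Subgroup (E ≃ᵃ[ℂ] E)} {v : V} :
    v ∈ translations W ↔ AffineEquiv.constVAdd ℂ E v ∈ W := Iff.rfl

lemma eq_constVAdd {γ : E ≃ᵃ[ℂ] E} (h : ∀ v, γ.linear v = v) (o : E) :
    γ = AffineEquiv.constVAdd ℂ E (γ o -ᵥ o) :=
  eq_of_linear_eq_of_apply_eq (fun v => by rw [h]; rfl) o (vsub_vadd _ _).symm

lemma vsub_mem_translations {W : Subgroup (E ≃ᵃ[ℂ] E)} {γ : E ≃ᵃ[ℂ] E} (hγ : γ ∈ W)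
    (h : ∀ v, γ.linear v = v) (o : E) : γ o -ᵥ o ∈ translations W := by
  rw [mem_translations, ← eq_constVAdd h o]; exact hγ

lemma linear_mem_translations {W : Subgroup (E ≃ᵃ[ℂ] E)} {γ : E ≃ᵃ[ℂ] E} (hγ : γ ∈ W) {v : V}
    (hv : v ∈ translations W) : γ.linear v ∈ translations W := by
  have h : AffineEquiv.constVAdd ℂ E (γ.linear v) = γ * AffineEquiv.constVAdd ℂ E v * γ⁻¹ := by
    ext x
    change γ.linear v +ᵥ x = γ (v +ᵥ γ⁻¹ x)
    rw [map_vadd_linear, apply_inv_self']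
  rw [mem_translations, h]
  exact W.mul_mem (W.mul_mem hγ hv) (W.inv_mem hγ)

end Translations

section Discrete

variable {V : Type*} [NormedAddCommGroup V] [InnerProductSpace ℂ V] [FiniteDimensional ℂ V]
  {E : Type*} [MetricSpace E] [NormedAddTorsor V E]

lemma IsDiscreteGroup.finite_translations_norm_le {W : Subgroup (E ≃ᵃ[ℂ] E)}
    (hd : IsDiscreteGroup W) (hiso : ∀ γ ∈ W, Isometry γ) (R : ℝ) :
    {v : V | v ∈ translations W ∧ ‖v‖ ≤ R}.Finite := by
  obtain ⟨o⟩ : Nonempty E := inferInstance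
  refine Set.Finite.of_finite_image (f := AffineEquiv.constVAdd ℂ E) ?_ fun v _ w _ h => ?_
  · refine (hd.finite_setOf_dist_le hiso o R).subset ?_
    rintro _ ⟨v, ⟨hv, hR⟩, rfl⟩
    exact ⟨hv, by simpa [dist_eq_norm_vsub V] using hR⟩
  · have := congrArg (fun f : E ≃ᵃ[ℂ] E => f o) h
    exact vadd_right_cancel o this

/-- An infinite discrete group of motions with irreducible linear part contains a nontrivial
translation. -/
lemma IsDiscreteGroup.exists_translation_ne_zero {W : Subgroup (E ≃ᵃ[ℂ] E)}
    (hd : IsDiscreteGroup W) (hiso : ∀ γ ∈ W, Isometry γ) (hinf : Infinite W)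
    (hirr : ∀ D : Submodule ℂ V, (∀ γ ∈ W, ∀ v ∈ D, γ.linear v ∈ D) → D = ⊥ ∨ D = ⊤) :
    ∃ v ∈ translations W, v ≠ 0 := by
  by_contra! h0
  obtain ⟨o⟩ : Nonempty E := inferInstance
  -- Without translations the linear part is faithful.
  have hinj : ∀ γ ∈ W, (∀ v, γ.linear v = v) → γ = 1 := by
    intro γ hγ h
    rw [eq_constVAdd h o, h0 _ (vsub_mem_translations hγ h o), AffineEquiv.constVAdd_zero]
    rfl
  let A : Set (E ≃ᵃ[ℂ] E) := {γ | γ ∈ W ∧ ‖linCLM γ - 1‖ < 1 / 8}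
  -- Otherwise the linear parts are $1/8$-separated in a bounded set and $W$ is finite.
  have hA : ∃ γ ∈ A, γ ≠ 1 := by
    by_contra! hA
    refine hinf.not_finite (Set.Finite.to_subtype ?_)
    have : ProperSpace (V →L[ℂ] V) := FiniteDimensional.proper ℂ _
    refine finite_of_bounded_of_separated (fun γ : E ≃ᵃ[ℂ] E => linCLM γ) _ ?_
      (by norm_num : (0 : ℝ) < 1 / 8) ?_
    · refine (Metric.isBounded_closedBall (x := (0 : V →L[ℂ] V)) (r := 1)).subset ?_
      rintro _ ⟨γ, hγ, rfl⟩
      rw [mem_closedBall_zero_iff]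
      exact norm_linCLM_le (hiso γ hγ)
    · intro γ hγ δ hδ hdist
      rw [dist_eq_norm] at hdist
      exact (inv_mul_eq_one.mp (hA (δ⁻¹ * γ) ⟨W.mul_mem (W.inv_mem hδ) hγ,
        (norm_linCLM_inv_mul_sub_one (hiso δ hδ)).trans_lt hdist⟩)).symm
  have hcomm : ∀ γ ∈ A, ∀ δ ∈ A, γ * δ = δ * γ := by
    intro γ hγ δ hδ
    rw [← inv_mul_eq_one]
    refine hinj _ (W.mul_mem (W.inv_mem (W.mul_mem hγ.1 hδ.1)) (W.mul_mem hδ.1 hγ.1)) fun v => ?_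
    rw [linear_mul, linear_mul, ← hd.linear_commute hiso hγ.1 hδ.1 hγ.2 hδ.2, ← linear_mul γ δ,
      linear_inv_apply]
  have hconj : ∀ δ ∈ W, ∀ γ ∈ A, δ⁻¹ * γ * δ ∈ A := by
    intro δ hδ γ hγ
    refine ⟨W.mul_mem (W.mul_mem (W.inv_mem hδ) hγ.1) hδ, lt_of_le_of_lt ?_ hγ.2⟩
    refine ContinuousLinearMap.opNorm_le_bound _ (norm_nonneg _) fun v => ?_
    have h : δ.linear ((linCLM (δ⁻¹ * γ * δ) - 1) v) = (linCLM γ - 1) (δ.linear v) := by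
      change δ.linear (δ⁻¹.linear (γ.linear (δ.linear v)) - v) = γ.linear (δ.linear v) - δ.linear v
      rw [map_sub, linear_apply_inv]
    rw [← norm_linear (hiso δ hδ), h, ← norm_linear (hiso δ hδ) v]
    exact ContinuousLinearMap.le_opNorm _ _
  -- The common fixed space of the linear parts of $A$ is invariant because $A$ is stable under
  -- conjugation. It is not $V$ since $A\ne\{1\}$, so it vanishes.
  let D : Submodule ℂ V :=
    ⨅ γ : A, LinearMap.ker ((γ : E ≃ᵃ[ℂ] E).linear.toLinearMap - LinearMap.id)
  have hD (v : V) : v ∈ D ↔ ∀ γ ∈ A, γ.linear v = v := by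
    simp [D, sub_eq_zero]
  have hDinv : ∀ δ ∈ W, ∀ v ∈ D, δ.linear v ∈ D := by
    intro δ hδ v hv
    rw [hD] at hv ⊢
    intro γ hγ
    have h1 := hv _ (hconj δ hδ γ hγ)
    rw [linear_mul, linear_mul] at h1
    rw [← linear_apply_inv δ (γ.linear (δ.linear v)), h1]
  have hfix : ∀ v : V, (∀ γ ∈ A, γ.linear v = v) → v = 0 := by
    rcases hirr D hDinv with h | h
    · intro v hv
      rwa [← hD, h, Submodule.mem_bot] at hv
    · obtain ⟨γ, hγ, hγ1⟩ := hA
      exact absurd (hinj γ hγ.1 fun v => (hD v).mp (h ▸ Submodule.mem_top) γ hγ) hγ1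
  obtain ⟨p, hp⟩ := exists_fixed_of_commute (fun γ hγ => hiso γ hγ.1) hcomm hfix
  -- As $D=0$, the fixed point of $A$ is unique, so $W$, which normalizes $A$, fixes it and would be
  -- finite.
  refine hinf.not_finite (hd.finite_of_fixed hiso (p := p) fun δ hδ => ?_)
  refine vsub_eq_zero_iff_eq.mp (hfix _ fun γ hγ => ?_)
  have h1 := hp _ (hconj δ hδ γ hγ)
  have h2 : γ (δ p) = δ p := by
    change δ⁻¹ (γ (δ p)) = p at h1
    rw [← apply_inv_self' δ (γ (δ p)), h1]
  rw [linear_vsub, h2, hp γ hγ]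

end Discrete

/-! ### Reflections, products and irreducibility of the linear part -/

section Reflection

variable {V : Type*} [NormedAddCommGroup V] [InnerProductSpace ℂ V]
  {E : Type*} [MetricSpace E] [NormedAddTorsor V E]

lemma mem_direction_fixedSubspace {γ : E ≃ᵃ[ℂ] E} {p : E} (hp : γ p = p) {v : V} :
    v ∈ (fixedSubspace γ).direction ↔ γ.linear v = v := by
  have hp' : p ∈ fixedSubspace γ := hp
  rw [← AffineSubspace.vadd_mem_iff_mem_direction v hp']
  change γ (v +ᵥ p) = v +ᵥ p ↔ _
  rw [map_vadd_linear, hp, vadd_right_cancel_iff]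

/-- A reflection has a fixed point, and moves every vector by a multiple of its root. -/
lemma IsReflection.exists_root [FiniteDimensional ℂ V] {γ : E ≃ᵃ[ℂ] E} (hγ : IsReflection γ) :
    ∃ (p : E) (a : V), γ p = p ∧ a ≠ 0 ∧ (∀ v, γ.linear v = v ↔ ⟪a, v⟫_ℂ = 0) ∧
      ∀ v, ∃ c : ℂ, γ.linear v - v = c • a := by
  obtain ⟨p, hp⟩ := hγ.nonempty
  change γ p = p at hp
  set H := (fixedSubspace γ).direction with hH
  have hH' (v : V) : v ∈ H ↔ γ.linear v = v := mem_direction_fixedSubspace hp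
  have hfin : Module.finrank ℂ Hᗮ = 1 := by
    have h1 := H.finrank_add_finrank_orthogonal
    have h2 : Module.finrank ℂ H + 1 = Module.finrank ℂ V := hγ.codim
    omega
  obtain ⟨a, ha0, ha⟩ := finrank_eq_one_iff'.mp hfin
  have hspan (w : V) (hw : w ∈ Hᗮ) : ∃ c : ℂ, w = c • (a : V) := by
    obtain ⟨c, hc⟩ := ha ⟨w, hw⟩
    exact ⟨c, (congrArg Subtype.val hc).symm⟩
  refine ⟨p, a, hp, fun h => ha0 (Subtype.ext h), fun v => ?_, fun v => hspan _ ?_⟩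
  · have hHH : v ∈ H ↔ v ∈ Hᗮᗮ := by rw [H.orthogonal_orthogonal]
    rw [← hH', hHH, Submodule.mem_orthogonal]
    refine ⟨fun h => h a a.2, fun h u hu => ?_⟩
    obtain ⟨c, rfl⟩ := hspan u hu
    rw [inner_smul_left, h, mul_zero]
  · rw [Submodule.mem_orthogonal]
    intro u hu
    have := inner_eigenvector_sub (B := γ.linear.toLinearMap) (norm_linear hγ.isometry) (c := 1)
      (k := u) (by rw [one_smul]; exact (hH' u).mp hu) v
    rwa [one_smul] at this

end Reflection

section Product

variable {V : Type*} [AddCommGroup V] [Module ℂ V] {E : Type*} [AddTorsor V E]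

/-- If every generator moves points along one of the summands of a decomposition of the space of
translations only, and its linear part fixes the other summand, then the group is a product. -/
lemma not_isIrreducible_of_split {d : Fin 2 → ℕ} (hd : ∀ j, 0 < d j)
    (q : ∀ j, V →ₗ[ℂ] EuclideanSpace ℂ (Fin (d j)))
    (e : ∀ j, EuclideanSpace ℂ (Fin (d j)) →ₗ[ℂ] V)
    (hqe : ∀ j y, q j (e j y) = y) (hqe' : ∀ i j y, i ≠ j → q i (e j y) = 0)
    (hsum : ∀ v, ∑ j, e j (q j v) = v) {S : Set (E ≃ᵃ[ℂ] E)}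
    (hS : ∀ γ ∈ S, ∃ j, (∀ x, ∀ i ≠ j, q i (γ x -ᵥ x) = 0) ∧
      ∀ i ≠ j, ∀ y, γ.linear (e i y) = e i y) :
    ¬ IsIrreducible (Subgroup.closure S) := by
  obtain ⟨o⟩ : Nonempty E := inferInstance
  set W := Subgroup.closure S with hW
  let L : V ≃ₗ[ℂ] ∀ j, EuclideanSpace ℂ (Fin (d j)) :=
    LinearEquiv.ofLinearMap (LinearMap.pi q) (∑ j, e j ∘ₗ LinearMap.proj j)
      (by
        ext1 j
        ext y i
        simp [Fin.sum_univ_two]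
        fin_cases i <;> fin_cases j <;> simp [hqe, hqe'])
      (by ext v; simpa using hsum v)
  let φ : E ≃ᵃ[ℂ] ∀ j, EuclideanSpace ℂ (Fin (d j)) :=
    (AffineEquiv.vaddConst ℂ o).symm.trans L.toAffineEquiv
  have hφ (x : E) (j : Fin 2) : φ x j = q j (x -ᵥ o) := rfl
  -- The factor $W'_j$ consists of the maps of the $j$-th space whose extension by the identity on
  -- the other one comes from $W$.
  let W' : ∀ j, Subgroup (EuclideanSpace ℂ (Fin (d j)) ≃ᵃ[ℂ] EuclideanSpace ℂ (Fin (d j))) :=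
    fun j =>
      { carrier := {δ | ∃ w ∈ W, ∀ x, φ (w x) = Function.update (φ x) j (δ (φ x j))}
        one_mem' := ⟨1, W.one_mem, fun x => (Function.update_eq_self j (φ x)).symm⟩
        mul_mem' := by
          rintro δ δ' ⟨w, hw, h⟩ ⟨w', hw', h'⟩
          refine ⟨w * w', W.mul_mem hw hw', fun x => ?_⟩
          change φ (w (w' x)) = Function.update (φ x) j (δ (δ' (φ x j)))
          rw [h, h', Function.update_self, Function.update_idem]
        inv_mem' := by
          rintro δ ⟨w, hw, h⟩
          refine ⟨w⁻¹, W.inv_mem hw, fun x => ?_⟩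
          obtain ⟨y, rfl⟩ := w.surjective x
          change φ (w.symm (w y)) = Function.update (φ (w y)) j (δ.symm (φ (w y) j))
          rw [h, w.symm_apply_apply, Function.update_self, δ.symm_apply_apply,
            Function.update_idem, Function.update_eq_self] }
  have hW' (j : Fin 2) (δ) : δ ∈ W' j ↔
    ∃ w ∈ W, ∀ x, φ (w x) = Function.update (φ x) j (δ (φ x j)) := Iff.rfl
  rw [IsIrreducible, not_not]
  refine ⟨2, d, W', le_rfl, hd, φ, ?_⟩
  have hsingle {j : Fin 2} {u : V} (hu : ∀ i ≠ j, q i u = 0) : e j (q j u) = u := by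
    conv_rhs => rw [← hsum u]
    symm
    refine Finset.sum_eq_single (f := fun k => e k (q k u)) j (fun i _ hi => ?_)
      fun h => absurd (Finset.mem_univ j) h
    rw [hu i hi, map_zero]
  have hgen (γ : E ≃ᵃ[ℂ] E) (hγ : γ ∈ S) : (φ.symm.trans γ).trans φ ∈ prodGroup W' := by
    obtain ⟨j, h1, h2⟩ := hS γ hγ
    have h3 (v : V) (i : Fin 2) (hi : i ≠ j) : q i (γ.linear v) = q i v := by
      have h := h1 (v +ᵥ o) i hi
      rw [γ.map_vadd, vadd_vsub_vadd_comm, map_add, h1 o i hi, add_zero, map_sub] at h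
      exact sub_eq_zero.mp h
    have h4 (v : V) (i : Fin 2) (hi : i ≠ j) : q i (γ.linear.symm v) = q i v := by
      rw [← h3 _ i hi, LinearEquiv.apply_symm_apply]
    -- The diagonal block of $\gamma$; its inverse is the block of $\gamma^{-1}$, because $\gamma$
    -- leaves the other coordinate unchanged and `hsingle` applies.
    let A : EuclideanSpace ℂ (Fin (d j)) ≃ₗ[ℂ] EuclideanSpace ℂ (Fin (d j)) :=
      LinearEquiv.ofLinearMap (q j ∘ₗ γ.linear.toLinearMap ∘ₗ e j)
        (q j ∘ₗ γ.linear.symm.toLinearMap ∘ₗ e j)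
        (by
          refine LinearMap.ext fun y => ?_
          change q j (γ.linear (e j (q j (γ.linear.symm (e j y))))) = y
          rw [hsingle fun i hi => by rw [h4 _ i hi, hqe' i j y hi], LinearEquiv.apply_symm_apply,
            hqe])
        (by
          refine LinearMap.ext fun y => ?_
          change q j (γ.linear.symm (e j (q j (γ.linear (e j y))))) = y
          rw [hsingle fun i hi => by rw [h3 _ i hi, hqe' i j y hi], LinearEquiv.symm_apply_apply,
            hqe])
    let δ : EuclideanSpace ℂ (Fin (d j)) ≃ᵃ[ℂ] EuclideanSpace ℂ (Fin (d j)) :=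
      A.toAffineEquiv.trans (AffineEquiv.constVAdd ℂ _ (q j (γ o -ᵥ o)))
    have hδ (y) : δ y = q j (γ o -ᵥ o) + q j (γ.linear (e j y)) := rfl
    have hγφ (x : E) : φ (γ x) = Function.update (φ x) j (δ (φ x j)) := by
      funext i
      rcases eq_or_ne i j with rfl | hi
      · rw [Function.update_self, hδ, hφ, hφ]
        have h5 : γ x -ᵥ o = (γ o -ᵥ o) + γ.linear (x -ᵥ o) := by
          rw [show γ.linear (x -ᵥ o) = γ x -ᵥ γ o from γ.toAffineMap.linearMap_vsub x o, add_comm,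
            vsub_add_vsub_cancel]
        have h6 (u : V) : q i (γ.linear u) = q i (γ.linear (e i (q i u))) := by
          have h7 : q i (γ.linear (u - e i (q i u))) = 0 := by
            have h8 : u - e i (q i u) = ∑ k ∈ Finset.univ.erase i, e k (q k u) := by
              rw [sub_eq_iff_eq_add, Finset.sum_erase_add _ _ (Finset.mem_univ i), hsum]
            rw [h8, map_sum, map_sum]
            refine Finset.sum_eq_zero fun k hk => ?_
            have hki := (Finset.mem_erase.mp hk).1
            rw [h2 k hki, hqe' i k _ hki.symm]
          rw [map_sub, map_sub] at h7
          exact sub_eq_zero.mp h7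
        rw [h5, map_add, ← h6]
      · rw [Function.update_of_ne hi, hφ, hφ, ← vsub_add_vsub_cancel (γ x) x o, map_add,
          h1 x i hi, zero_add]
    refine ⟨Function.update (fun _ => 1) j δ, fun i => ?_, fun y i => ?_⟩
    · rcases eq_or_ne i j with rfl | hi
      · rw [Function.update_self]
        exact ⟨γ, Subgroup.subset_closure hγ, hγφ⟩
      · rw [Function.update_of_ne hi]
        exact (W' i).one_mem
    · change φ (γ (φ.symm y)) i = _
      rw [hγφ, φ.apply_symm_apply]
      rcases eq_or_ne i j with rfl | hi
      · rw [Function.update_self, Function.update_self]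
      · rw [Function.update_of_ne hi, Function.update_of_ne hi]; rfl
  apply Set.Subset.antisymm
  · rintro γ' ⟨δ, hδ, h⟩
    obtain ⟨w₀, hw₀, h₀⟩ := (hW' 0 _).mp (hδ 0)
    obtain ⟨w₁, hw₁, h₁⟩ := (hW' 1 _).mp (hδ 1)
    refine ⟨w₀ * w₁, W.mul_mem hw₀ hw₁, ?_⟩
    ext y : 1
    change φ (w₀ (w₁ (φ.symm y))) = γ' y
    rw [h₀, h₁, φ.apply_symm_apply]
    funext i
    rw [h]
    fin_cases i
    · simp
    · simp
  · rintro _ ⟨γ, hγ, rfl⟩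
    change (φ.symm.trans γ).trans φ ∈ prodGroup W'
    induction hγ using Subgroup.closure_induction with
    | mem x hx => exact hgen x hx
    | one =>
      convert (prodGroup W').one_mem using 1
      ext y : 1
      exact φ.apply_symm_apply y
    | mul x y _ _ hx hy =>
      convert (prodGroup W').mul_mem hx hy using 1
      ext z : 1
      change φ (x (y _)) = φ (x (φ.symm (φ (y _))))
      rw [φ.symm_apply_apply]
    | inv x _ hx =>
      convert (prodGroup W').inv_mem hx using 1
      ext z : 1
      rfl

end Product

section Irreducible

variable {V : Type*} [NormedAddCommGroup V] [InnerProductSpace ℂ V] [FiniteDimensional ℂ V]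
  {E : Type*} [MetricSpace E] [NormedAddTorsor V E]

/-- The linear part of an irreducible `r`-group is irreducible. -/
lemma IsRGroup.eq_bot_or_eq_top {W : Subgroup (E ≃ᵃ[ℂ] E)} (hW : IsRGroup W)
    (hirr : IsIrreducible W) (D : Submodule ℂ V) (hD : ∀ γ ∈ W, ∀ v ∈ D, γ.linear v ∈ D) :
    D = ⊥ ∨ D = ⊤ := by
  by_contra! hne
  obtain ⟨S, hS, rfl⟩ := hW.generated
  let D' : Fin 2 → Submodule ℂ V := ![D, Dᗮ]
  have hd (j : Fin 2) : 0 < Module.finrank ℂ (D' j) := by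
    rw [Nat.pos_iff_ne_zero, ne_eq, Submodule.finrank_eq_zero]
    fin_cases j
    · exact hne.1
    · change Dᗮ ≠ ⊥
      rw [ne_eq, Submodule.orthogonal_eq_bot_iff]
      exact hne.2
  have horth {i j : Fin 2} (hij : i ≠ j) {x y : V} (hx : x ∈ D' i) (hy : y ∈ D' j) :
      ⟪x, y⟫_ℂ = 0 := by
    fin_cases i <;> fin_cases j
    · exact absurd rfl hij
    · exact (Submodule.mem_orthogonal _ _).mp hy _ hx
    · exact (Submodule.mem_orthogonal' _ _).mp hx _ hy
    · exact absurd rfl hij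
  have hproj0 {i j : Fin 2} (hij : i ≠ j) {y : V} (hy : y ∈ D' j) :
      (D' i).orthogonalProjectionOnto y = 0 := by
    rw [Submodule.orthogonalProjectionOnto_eq_zero_iff, Submodule.mem_orthogonal]
    exact fun u hu => horth hij hu hy
  let r (j : Fin 2) := (stdOrthonormalBasis ℂ (D' j)).repr
  refine not_isIrreducible_of_split (d := fun j => Module.finrank ℂ (D' j)) hd
    (fun j => (r j).toLinearEquiv.toLinearMap ∘ₗ (D' j).orthogonalProjectionOnto.toLinearMap)
    (fun j => (D' j).subtype ∘ₗ (r j).symm.toLinearEquiv.toLinearMap)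
    (fun j y => ?_) (fun i j y hij => ?_) (fun v => ?_) (S := S) (fun γ hγ => ?_) hirr
  · change r j ((D' j).orthogonalProjectionOnto ((r j).symm y : V)) = y
    rw [Submodule.orthogonalProjectionOnto_mem_subspace_eq_self, LinearIsometryEquiv.apply_symm_apply]
  · change r i ((D' i).orthogonalProjectionOnto ((r j).symm y : V)) = 0
    rw [hproj0 hij ((r j).symm y).2, map_zero]
  · change ∑ j, (((r j).symm (r j ((D' j).orthogonalProjectionOnto v)) : D' j) : V) = v
    simp only [LinearIsometryEquiv.symm_apply_apply, Fin.sum_univ_two]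
    exact Submodule.starProjection_add_starProjection_orthogonal v
  · obtain ⟨p, a, hp, ha0, hfix, hmove⟩ := (hS γ hγ).exists_root
    -- Either $\gamma$ is trivial on $D$ and $a\perp D$, or some $\gamma x-x$ with $x\in D$ is a
    -- nonzero multiple of $a$.
    have hdich : ∃ j, a ∈ D' j := by
      by_cases h : ∀ x ∈ D, γ.linear x = x
      · refine ⟨1, (Submodule.mem_orthogonal' _ _).mpr fun u hu => (hfix u).mp (h u hu)⟩
      · push Not at h
        obtain ⟨x, hx, hne⟩ := h
        obtain ⟨c, hc⟩ := hmove x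
        have hc0 : c ≠ 0 := by
          rintro rfl
          rw [zero_smul, sub_eq_zero] at hc
          exact hne hc
        refine ⟨0, (D.smul_mem_iff hc0).mp ?_⟩
        rw [← hc]
        exact D.sub_mem (hD γ (Subgroup.subset_closure hγ) x hx) hx
    obtain ⟨j, hj⟩ := hdich
    refine ⟨j, fun x i hi => ?_, fun i hi y => ?_⟩
    · change r i ((D' i).orthogonalProjectionOnto (γ x -ᵥ x)) = 0
      obtain ⟨c, hc⟩ := hmove (x -ᵥ p)
      rw [linear_vsub, hp, vsub_sub_vsub_cancel_right] at hc
      rw [hc, hproj0 hi ((D' j).smul_mem c hj), map_zero]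
    · exact (hfix _).mpr (horth hi.symm hj ((r i).symm y).2)

end Irreducible

/-! ### Cocompactness from a full lattice -/

section Cocompact

variable {V : Type*} [NormedAddCommGroup V] [InnerProductSpace ℂ V] [FiniteDimensional ℂ V]
  {E : Type*} [MetricSpace E] [NormedAddTorsor V E]

/-- A group containing a full lattice of translations acts cocompactly. -/
lemma compactSpace_of_span_translations {W : Subgroup (E ≃ᵃ[ℂ] E)}
    (h : Submodule.span ℝ (translations W : Set V) = ⊤) :
    CompactSpace (Quotient (orbitSetoid W)) := by
  obtain ⟨o⟩ : Nonempty E := inferInstance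
  obtain ⟨b, hbT, hb, hli⟩ := exists_linearIndependent ℝ (translations W : Set V)
  have : Module.Finite ℝ V := Module.Finite.trans ℂ V
  have : Fintype b := hli.setFinite.fintype
  rw [h] at hb
  -- A basis of translations has a compact parallelepiped meeting every orbit: the integer parts of
  -- the coordinates are removed by elements of $W$.
  let f : (b → ℝ) → Quotient (orbitSetoid W) := fun c => ⟦(∑ i, c i • (i : V)) +ᵥ o⟧
  have hf : Continuous f := by
    refine continuous_quotient_mk'.comp (Continuous.vadd ?_ continuous_const)
    exact continuous_finsetSum _ fun i _ => (continuous_apply i).smul continuous_const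
  refine ⟨?_⟩
  have himg : f '' (Set.Icc 0 1) = Set.univ := by
    rw [Set.eq_univ_iff_forall]
    refine Quotient.ind fun x => ?_
    have hx : x -ᵥ o ∈ Submodule.span ℝ (Set.range ((↑) : b → V)) := by
      rw [Subtype.range_coe, hb]; trivial
    obtain ⟨c, hc⟩ := (Submodule.mem_span_range_iff_exists_fun ℝ).mp hx
    refine ⟨fun i => Int.fract (c i), ⟨fun i => Int.fract_nonneg _,
      fun i => (Int.fract_lt_one _).le⟩, Quotient.sound ?_⟩
    refine ⟨AffineEquiv.constVAdd ℂ E (∑ i, ⌊c i⌋ • (i : V)), ?_, ?_⟩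
    · exact mem_translations.mp
        (sum_mem fun i _ => zsmul_mem (hbT i.2) _)
    · change (∑ i, ⌊c i⌋ • (i : V)) +ᵥ ((∑ i, Int.fract (c i) • (i : V)) +ᵥ o) = x
      rw [vadd_vadd, ← Finset.sum_add_distrib]
      simp_rw [← Int.cast_smul_eq_zsmul ℝ, ← add_smul, Int.floor_add_fract]
      rw [hc, vsub_vadd]
  rw [← himg]
  exact isCompact_Icc.image hf

end Cocompact

/-! ### Totally real subspaces -/

section TotallyReal

variable {V : Type*} [NormedAddCommGroup V] [InnerProductSpace ℂ V]

lemma smul_eq_re_add_im (c : ℂ) (x : V) : c • x = c.re • x + c.im • (Complex.I • x) := by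
  conv_lhs => rw [← Complex.re_add_im c]
  rw [add_smul, mul_smul, Complex.coe_smul, Complex.coe_smul]

lemma im_eq_zero_of_smul_mem {U : Submodule ℝ V} (hU : ∀ x ∈ U, Complex.I • x ∈ U → x = 0)
    {x : V} (hx : x ∈ U) (hx0 : x ≠ 0) {c : ℂ} (hc : c • x ∈ U) : c.im = 0 := by
  by_contra hne
  rw [smul_eq_re_add_im] at hc
  have h1 : c.im • (Complex.I • x) ∈ U := by
    simpa using U.sub_mem hc (U.smul_mem c.re hx)
  exact hx0 (hU x hx ((U.smul_mem_iff hne).mp h1))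

lemma exists_of_mem_span_complex {R : Submodule ℝ V} {v : V}
    (hv : v ∈ Submodule.span ℂ (R : Set V)) : ∃ x ∈ R, ∃ y ∈ R, v = x + Complex.I • y := by
  induction hv using Submodule.span_induction with
  | mem x hx => exact ⟨x, hx, 0, R.zero_mem, by simp⟩
  | zero => exact ⟨0, R.zero_mem, 0, R.zero_mem, by simp⟩
  | add u v _ _ hu hv =>
    obtain ⟨x, hx, y, hy, rfl⟩ := hu
    obtain ⟨x', hx', y', hy', rfl⟩ := hv
    exact ⟨x + x', R.add_mem hx hx', y + y', R.add_mem hy hy', by rw [smul_add]; abel⟩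
  | smul c v _ hv =>
    obtain ⟨x, hx, y, hy, rfl⟩ := hv
    refine ⟨c.re • x - c.im • y, R.sub_mem (R.smul_mem _ hx) (R.smul_mem _ hy),
      c.re • y + c.im • x, R.add_mem (R.smul_mem _ hy) (R.smul_mem _ hx), ?_⟩
    rw [smul_add, smul_eq_re_add_im c x, smul_eq_re_add_im c (Complex.I • y), smul_smul Complex.I,
      Complex.I_mul_I, neg_one_smul, smul_add, smul_comm Complex.I c.re, smul_comm Complex.I c.im]
    simp only [smul_neg]
    abel

/-- Each $u\in U$ is $x+iy$ with $x,y\in R$; then $iy=u-x\in U$, so $y=0$. -/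
lemma eq_of_le_of_span_complex {R U : Submodule ℝ V} (hU : ∀ x ∈ U, Complex.I • x ∈ U → x = 0)
    (hRU : R ≤ U) (hR : Submodule.span ℂ (R : Set V) = ⊤) : R = U := by
  refine le_antisymm hRU fun u hu => ?_
  obtain ⟨x, hx, y, hy, rfl⟩ := exists_of_mem_span_complex (R := R) (v := u) (hR ▸ trivial)
  have h1 : Complex.I • y ∈ U := by simpa using U.sub_mem hu (hRU hx)
  rw [hU y (hRU hy) h1, smul_zero, add_zero]
  exact hx

/-- The largest complex subspace contained in a real subspace. -/
noncomputable def complexPart (U : Submodule ℝ V) : Submodule ℂ V where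
  carrier := {x | x ∈ U ∧ Complex.I • x ∈ U}
  zero_mem' := by simp
  add_mem' := fun {x y} hx hy => ⟨U.add_mem hx.1 hy.1, by
    rw [smul_add]; exact U.add_mem hx.2 hy.2⟩
  smul_mem' := fun c x hx => by
    have h : ∀ c : ℂ, c • x ∈ U := fun c => by
      rw [smul_eq_re_add_im]
      exact U.add_mem (U.smul_mem _ hx.1) (U.smul_mem _ hx.2)
    exact ⟨h c, by rw [smul_smul]; exact h _⟩

lemma mem_complexPart {U : Submodule ℝ V} {x : V} :
    x ∈ complexPart U ↔ x ∈ U ∧ Complex.I • x ∈ U := Iff.rfl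

end TotallyReal

/-! ### The translation lattice and its primitive roots -/

section Lattice

variable {V : Type*} [NormedAddCommGroup V] [InnerProductSpace ℂ V]
  {E : Type*} [MetricSpace E] [NormedAddTorsor V E]

/-- The real span of the translations of `W`. -/
noncomputable def translationSpan (W : Subgroup (E ≃ᵃ[ℂ] E)) : Submodule ℝ V :=
  Submodule.span ℝ (translations W : Set V)

lemma translations_subset_span {W : Subgroup (E ≃ᵃ[ℂ] E)} {v : V} (hv : v ∈ translations W) :
    v ∈ translationSpan W := Submodule.subset_span hv

lemma map_real_smul (f : V →ₗ[ℂ] V) (r : ℝ) (v : V) : f (r • v) = r • f v :=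
  LinearMap.map_smul_of_tower f r v

lemma linear_mem_translationSpan {W : Subgroup (E ≃ᵃ[ℂ] E)} {γ : E ≃ᵃ[ℂ] E} (hγ : γ ∈ W) {v : V}
    (hv : v ∈ translationSpan W) : γ.linear v ∈ translationSpan W := by
  induction hv using Submodule.span_induction with
  | mem x hx => exact Submodule.subset_span (linear_mem_translations hγ hx)
  | zero => rw [map_zero]; exact zero_mem _
  | add u v _ _ hu hv => rw [map_add]; exact add_mem hu hv
  | smul c v _ hv =>
    have h : γ.linear (c • v) = c • γ.linear v := map_real_smul γ.linear.toLinearMap c v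
    rw [h]; exact Submodule.smul_mem _ _ hv

/-- The map `v ↦ v - 2 ⟪a, v⟫ / ⟪a, a⟫ a`, written out for a vector. -/
noncomputable def rootReflection (a v : V) : V := v - (2 * ⟪a, v⟫_ℂ / ⟪a, a⟫_ℂ) • a

lemma inner_self_ne_zero' {a : V} (ha : a ≠ 0) : ⟪a, a⟫_ℂ ≠ 0 := inner_self_ne_zero.mpr ha

lemma rootReflection_smul {c : ℂ} (hc : c ≠ 0) (a v : V) :
    rootReflection (c • a) v = rootReflection a v := by
  rcases eq_or_ne a 0 with rfl | ha
  · simp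
  unfold rootReflection
  rw [inner_smul_left, inner_smul_left, inner_smul_right, smul_smul]
  congr 2
  have h1 := inner_self_ne_zero' ha
  have h2 : (starRingEnd ℂ) c ≠ 0 := (map_ne_zero _).mpr hc
  field_simp

/-- `a` is a primitive translation of `W` in the direction of the root of a real reflection
of `W`. -/
structure IsPrimitiveRoot (W : Subgroup (E ≃ᵃ[ℂ] E)) (a : V) : Prop where
  mem : a ∈ translations W
  ne_zero : a ≠ 0
  primitive : ∀ c : ℝ, c • a ∈ translations W → ∃ n : ℤ, c = n
  exists_reflection : ∃ γ ∈ W, (∃ p, γ p = p) ∧ ∀ v, γ.linear v = rootReflection a v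

lemma inner_linear {γ : E ≃ᵃ[ℂ] E} (hγ : Isometry γ) (x y : V) :
    ⟪γ.linear x, γ.linear y⟫_ℂ = ⟪x, y⟫_ℂ :=
  inner_map_map_of_norm (B := γ.linear.toLinearMap) (norm_linear hγ) x y

lemma linear_rootReflection {γ : E ≃ᵃ[ℂ] E} (hγ : Isometry γ) (a v : V) :
    γ.linear (rootReflection a v) = rootReflection (γ.linear a) (γ.linear v) := by
  unfold rootReflection
  rw [map_sub, map_smul, inner_linear hγ, inner_linear hγ]

lemma conj_linear {γ δ : E ≃ᵃ[ℂ] E} (hδ : Isometry δ) {a : V}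
    (h : ∀ v, γ.linear v = rootReflection a v) (v : V) :
    (δ * γ * δ⁻¹).linear v = rootReflection (δ.linear a) v := by
  change δ.linear (γ.linear (δ⁻¹.linear v)) = _
  rw [h, linear_rootReflection hδ, linear_apply_inv]

/-- The linear part of the group permutes the primitive roots. -/
lemma IsPrimitiveRoot.map {W : Subgroup (E ≃ᵃ[ℂ] E)} (hiso : ∀ γ ∈ W, Isometry γ) {a : V}
    (ha : IsPrimitiveRoot W a) {δ : E ≃ᵃ[ℂ] E} (hδ : δ ∈ W) :
    IsPrimitiveRoot W (δ.linear a) where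
  mem := linear_mem_translations hδ ha.mem
  ne_zero := by
    rw [ne_eq, LinearEquiv.map_eq_zero_iff]
    exact ha.ne_zero
  primitive c hc := by
    refine ha.primitive c ?_
    have h : δ.linear (c • a) = c • δ.linear a := map_real_smul δ.linear.toLinearMap c a
    rw [← linear_inv_apply δ (c • a), h]
    exact linear_mem_translations (W.inv_mem hδ) hc
  exists_reflection := by
    obtain ⟨γ, hγ, ⟨p, hp⟩, h⟩ := ha.exists_reflection
    refine ⟨δ * γ * δ⁻¹, W.mul_mem (W.mul_mem hδ hγ) (W.inv_mem hδ), ⟨δ p, ?_⟩,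
      conj_linear (hiso δ hδ) h⟩
    change δ (γ (δ⁻¹ (δ p))) = δ p
    rw [inv_apply_self', hp]

/-- The Cartan integers of the primitive roots. -/
lemma IsPrimitiveRoot.exists_int {W : Subgroup (E ≃ᵃ[ℂ] E)}
    (hU : ∀ x ∈ translationSpan W, Complex.I • x ∈ translationSpan W → x = 0) {a : V}
    (ha : IsPrimitiveRoot W a) {t : V} (ht : t ∈ translations W) :
    ∃ n : ℤ, 2 * ⟪a, t⟫_ℂ / ⟪a, a⟫_ℂ = n := by
  obtain ⟨γ, hγ, -, h⟩ := ha.exists_reflection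
  -- The difference of $t$ and its reflection is a translation along $a$; total reality makes the
  -- coefficient real and primitivity makes it integral.
  have h1 : (2 * ⟪a, t⟫_ℂ / ⟪a, a⟫_ℂ) • a ∈ translations W := by
    have h2 := linear_mem_translations hγ ht
    rw [h, rootReflection] at h2
    simpa using sub_mem ht h2
  have h2 := im_eq_zero_of_smul_mem hU (translations_subset_span ha.mem) ha.ne_zero
    (translations_subset_span h1)
  rw [smul_eq_re_add_im, h2, zero_smul, add_zero] at h1
  obtain ⟨n, hn⟩ := ha.primitive _ h1
  exact ⟨n, Complex.ext (by simpa using hn) (by simpa using h2)⟩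

/-- Integrality of the Cartan numbers and reality of $\langle a\mid a\rangle$ give the claim on
translations; it extends by real linearity. -/
lemma IsPrimitiveRoot.inner_im {W : Subgroup (E ≃ᵃ[ℂ] E)}
    (hU : ∀ x ∈ translationSpan W, Complex.I • x ∈ translationSpan W → x = 0) {a : V}
    (ha : IsPrimitiveRoot W a) {x : V} (hx : x ∈ translationSpan W) : (⟪a, x⟫_ℂ).im = 0 := by
  induction hx using Submodule.span_induction with
  | mem t ht =>
    obtain ⟨n, hn⟩ := ha.exists_int hU ht
    rw [div_eq_iff (inner_self_ne_zero' ha.ne_zero)] at hn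
    have h1 : (⟪a, a⟫_ℂ).im = 0 := inner_self_im (𝕜 := ℂ) a
    have h2 := congrArg Complex.im hn
    rw [Complex.mul_im, Complex.mul_im, h1] at h2
    simpa using h2
  | zero => simp
  | add u v _ _ hu hv => rw [inner_add_right, Complex.add_im, hu, hv, add_zero]
  | smul c v _ hv =>
    rw [← Complex.coe_smul, inner_smul_right, Complex.im_ofReal_mul, hv, mul_zero]

/-- The translations of an irreducible group span the space over `ℂ`. -/
lemma span_translations_eq_top {W : Subgroup (E ≃ᵃ[ℂ] E)}
    (hirr : ∀ D : Submodule ℂ V, (∀ γ ∈ W, ∀ v ∈ D, γ.linear v ∈ D) → D = ⊥ ∨ D = ⊤)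
    (hT : ∃ v ∈ translations W, v ≠ (0 : V)) :
    Submodule.span ℂ (translations W : Set V) = ⊤ := by
  refine (hirr _ fun γ hγ v hv => ?_).resolve_left fun h => ?_
  · induction hv using Submodule.span_induction with
    | mem x hx => exact Submodule.subset_span (linear_mem_translations hγ hx)
    | zero => rw [map_zero]; exact zero_mem _
    | add u v _ _ hu hv => rw [map_add]; exact add_mem hu hv
    | smul c v _ hv => rw [map_smul]; exact Submodule.smul_mem _ _ hv
  · obtain ⟨v, hv, hv0⟩ := hT
    exact hv0 ((Submodule.mem_bot ℂ).mp (h ▸ Submodule.subset_span hv))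

/-- The Hermitian product is real on the real span of the translations. -/
lemma inner_im_eq_zero {W : Subgroup (E ≃ᵃ[ℂ] E)}
    (hU : ∀ x ∈ translationSpan W, Complex.I • x ∈ translationSpan W → x = (0 : V))
    (hspan : Submodule.span ℝ {a | IsPrimitiveRoot W a} = translationSpan W)
    {x y : V} (hx : x ∈ translationSpan W) (hy : y ∈ translationSpan W) : (⟪x, y⟫_ℂ).im = 0 := by
  rw [← hspan] at hx
  induction hx using Submodule.span_induction with
  | mem a ha => exact IsPrimitiveRoot.inner_im hU ha hy
  | zero => simp
  | add u v _ _ hu hv => rw [inner_add_left, Complex.add_im, hu, hv, add_zero]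
  | smul c v _ hv =>
    rw [← Complex.coe_smul, inner_smul_left, Complex.conj_ofReal, Complex.im_ofReal_mul, hv,
      mul_zero]

variable [FiniteDimensional ℂ V]

/-- Every reflection of the group has a primitive root. -/
lemma IsReflection.exists_isPrimitiveRoot {W : Subgroup (E ≃ᵃ[ℂ] E)} (hd : IsDiscreteGroup W)
    (hiso : ∀ γ ∈ W, Isometry γ)
    (hU : ∀ x ∈ translationSpan W, Complex.I • x ∈ translationSpan W → x = 0)
    (htop : Submodule.span ℂ (translations W : Set V) = ⊤) {γ : E ≃ᵃ[ℂ] E} (hγW : γ ∈ W)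
    (hγ : IsReflection γ) :
    ∃ a, IsPrimitiveRoot W a ∧ ∀ v, γ.linear v = rootReflection a v := by
  obtain ⟨p, a₀, hp, ha₀, hfix, hmove⟩ := hγ.exists_root
  -- The translations span $V$ over $\mathbb C$, so some $t$ is moved, and $b=\gamma t-t$ is a root
  -- of $\gamma$ that is itself a translation.
  obtain ⟨t, ht, htne⟩ : ∃ t ∈ translations W, γ.linear t ≠ t := by
    by_contra! hcon
    have h1 (w : V) (hw : w ∈ Submodule.span ℂ (translations W : Set V)) : γ.linear w = w := by
      clear hfix hmove
      induction hw using Submodule.span_induction with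
      | mem x hx => exact hcon x hx
      | zero => exact map_zero _
      | add u v _ _ hu hv => rw [map_add, hu, hv]
      | smul c v _ hv => rw [map_smul, hv]
    exact ha₀ (inner_self_eq_zero.mp ((hfix a₀).mp (h1 a₀ (htop ▸ trivial))))
  set b := γ.linear t - t with hb
  have hbT : b ∈ translations W := sub_mem (linear_mem_translations hγW ht) ht
  have hb0 : b ≠ 0 := sub_ne_zero.mpr htne
  obtain ⟨c, hc⟩ := hmove t
  have hc0 : c ≠ 0 := by rintro rfl; exact hb0 (by rw [hb, hc, zero_smul])
  have hmove' (v : V) : ∃ k : ℂ, γ.linear v - v = k • b := by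
    obtain ⟨k, hk⟩ := hmove v
    exact ⟨k / c, by rw [hb, hc, smul_smul, div_mul_cancel₀ _ hc0, hk]⟩
  have hbfix : γ.linear b ≠ b := by
    rw [ne_eq, hfix, hb, hc, inner_smul_right]
    exact mul_ne_zero hc0 (inner_self_ne_zero' ha₀)
  obtain ⟨k, hk⟩ := hmove' b
  have hl : γ.linear b = (k + 1) • b := by rw [add_smul, one_smul, ← hk, sub_add_cancel]
  have him := im_eq_zero_of_smul_mem hU (translations_subset_span hbT) hb0
    (hl ▸ linear_mem_translationSpan hγW (translations_subset_span hbT))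
  -- The eigenvalue on $b$ is real by total reality, has modulus $1$ and is not $1$: here
  -- reflections of higher order are excluded.
  have hl1 : k + 1 = -1 := by
    have h1 := norm_linear hγ.isometry b
    rw [hl, norm_smul] at h1
    have h2 : ‖k + 1‖ = 1 := mul_right_cancel₀ (norm_ne_zero_iff.mpr hb0) (by rw [h1, one_mul])
    have h3 : k + 1 = ((k + 1).re : ℂ) := Complex.ext (by simp) (by simpa using him)
    rw [h3, Complex.norm_real, Real.norm_eq_abs] at h2
    rcases (abs_eq zero_le_one).mp h2 with h4 | h4
    · rw [h3, h4] at hl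
      exact absurd (by simpa using hl) hbfix
    · rw [h3, h4]; simp
  rw [hl1] at hl
  have hrefl (v : V) : γ.linear v = rootReflection b v := by
    obtain ⟨m, hm⟩ := hmove' v
    have h1 := inner_eigenvector_map (B := γ.linear.toLinearMap) (norm_linear hγ.isometry) hl v
    change ⟪b, γ.linear v⟫_ℂ = _ at h1
    have h2 := congrArg (fun w => ⟪b, w⟫_ℂ) hm
    simp only [inner_sub_right, inner_smul_right] at h2
    rw [h1] at h2
    have h3 : 2 * ⟪b, v⟫_ℂ / ⟪b, b⟫_ℂ = -m := by
      rw [div_eq_iff (inner_self_ne_zero' hb0)]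
      linear_combination -h2
    rw [rootReflection, h3, neg_smul, sub_neg_eq_add, ← hm, add_sub_cancel]
  -- A shortest nonzero translation on the line $\mathbb Rb$ is primitive, since a fractional part
  -- would give a shorter one. The bound $\|b\|$ makes the set of candidates finite.
  let S : Set V := {v | (v ∈ translations W ∧ ‖v‖ ≤ ‖b‖) ∧ v ≠ 0 ∧ ∃ r : ℝ, v = r • b}
  have hSfin : S.Finite := (hd.finite_translations_norm_le hiso ‖b‖).subset fun v hv => hv.1
  obtain ⟨a, ⟨⟨haT, hab⟩, ha0, r, hr⟩, hmin⟩ := Set.exists_min_image S (fun v => ‖v‖) hSfin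
    ⟨b, ⟨hbT, le_rfl⟩, hb0, 1, (one_smul _ _).symm⟩
  have hr0 : (r : ℂ) ≠ 0 := by
    rintro h
    rw [Complex.ofReal_eq_zero] at h
    exact ha0 (by rw [hr, h, zero_smul])
  have hrefl' (v : V) : γ.linear v = rootReflection a v := by
    rw [hr, ← Complex.coe_smul, rootReflection_smul hr0, hrefl]
  refine ⟨a, ⟨haT, ha0, fun c hc => ⟨⌊c⌋, ?_⟩, γ, hγW, ⟨p, hp⟩, hrefl'⟩, hrefl'⟩
  have h1 : Int.fract c • a ∈ translations W := by
    rw [Int.fract, sub_smul, Int.cast_smul_eq_zsmul]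
    exact sub_mem hc (zsmul_mem haT _)
  have h2 : ‖Int.fract c • a‖ < ‖a‖ := by
    rw [norm_smul, Real.norm_eq_abs, abs_of_nonneg (Int.fract_nonneg c)]
    exact mul_lt_of_lt_one_left (norm_pos_iff.mpr ha0) (Int.fract_lt_one c)
  have h3 : Int.fract c • a = 0 := by
    by_contra h3
    have := hmin _ ⟨⟨h1, (h2.le).trans hab⟩, h3, Int.fract c * r, by rw [hr, smul_smul]⟩
    exact absurd h2 (not_lt.mpr this)
  have h4 := (smul_eq_zero.mp h3).resolve_right ha0
  rw [Int.fract, sub_eq_zero] at h4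
  exact h4

/-- The translations of an irreducible noncrystallographic group span a totally real subspace. -/
lemma eq_zero_of_I_smul_mem {W : Subgroup (E ≃ᵃ[ℂ] E)}
    (hirr : ∀ D : Submodule ℂ V, (∀ γ ∈ W, ∀ v ∈ D, γ.linear v ∈ D) → D = ⊥ ∨ D = ⊤)
    (hnc : IsNoncrystallographic W) :
    ∀ x ∈ translationSpan W, Complex.I • x ∈ translationSpan W → x = 0 := by
  intro x hx hIx
  -- If the invariant complex part is all of $V$, the translations span $V$ over $\mathbb R$ and the
  -- quotient is compact.
  rcases hirr (complexPart (translationSpan W)) fun γ hγ v hv => ⟨linear_mem_translationSpan hγ hv.1,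
    by rw [← map_smul]; exact linear_mem_translationSpan hγ hv.2⟩ with h | h
  · have : x ∈ complexPart (translationSpan W) := ⟨hx, hIx⟩
    rwa [h, Submodule.mem_bot] at this
  · refine absurd (compactSpace_of_span_translations (W := W) ?_) hnc
    rw [eq_top_iff]
    intro v _
    exact (mem_complexPart.mp (h ▸ trivial : v ∈ complexPart (translationSpan W))).1

/-- The primitive roots span the real span of the translations. -/
lemma span_isPrimitiveRoot {W : Subgroup (E ≃ᵃ[ℂ] E)} (hW : IsRGroup W) (hinf : Infinite W)
    (hirr : ∀ D : Submodule ℂ V, (∀ γ ∈ W, ∀ v ∈ D, γ.linear v ∈ D) → D = ⊥ ∨ D = ⊤)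
    (hU : ∀ x ∈ translationSpan W, Complex.I • x ∈ translationSpan W → x = 0)
    (htop : Submodule.span ℂ (translations W : Set V) = ⊤) :
    Submodule.span ℝ {a | IsPrimitiveRoot W a} = translationSpan W := by
  obtain ⟨S, hS, hWS⟩ := hW.generated
  refine eq_of_le_of_span_complex hU
    (Submodule.span_le.mpr fun a ha => translations_subset_span ha.mem) ?_
  -- Every generator fixes the complement of the roots, so it is invariant. If it were $V$, no
  -- reflection could exist and $W$ would be trivial.
  let D : Submodule ℂ V := (Submodule.span ℂ {a | IsPrimitiveRoot W a})ᗮ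
  have hD (γ : E ≃ᵃ[ℂ] E) (hγ : γ ∈ W) : ∀ v ∈ D, γ.linear v = v := by
    rw [hWS] at hγ
    induction hγ using Subgroup.closure_induction with
    | mem γ hγ =>
      intro v hv
      obtain ⟨a, ha, h⟩ := (hS γ hγ).exists_isPrimitiveRoot hW.discrete (fun _ => hW.isometry) hU
        htop (hWS ▸ Subgroup.subset_closure hγ)
      rw [h, rootReflection, (Submodule.mem_orthogonal _ _).mp hv a (Submodule.subset_span ha)]
      simp
    | one => exact fun _ _ => rfl
    | mul x y _ _ hx hy =>
      intro v hv
      rw [linear_mul, hy v hv, hx v hv]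
    | inv x _ hx =>
      intro v hv
      conv_lhs => rw [← hx v hv]
      exact linear_inv_apply x v
  have hspan : Submodule.span ℂ {a : V | IsPrimitiveRoot W a} = ⊤ := by
    rw [← Submodule.orthogonal_eq_bot_iff]
    refine (hirr D fun γ hγ v hv => by rwa [hD γ hγ v hv]).resolve_right fun h => ?_
    have hS1 : S = ∅ := by
      rw [Set.eq_empty_iff_forall_notMem]
      intro γ hγ
      obtain ⟨p, a, -, ha0, hfix, -⟩ := (hS γ hγ).exists_root
      exact ha0 (inner_self_eq_zero.mp ((hfix a).mp
        (hD γ (hWS ▸ Subgroup.subset_closure hγ) a (h ▸ trivial))))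
    rw [hS1, Subgroup.closure_empty] at hWS
    subst hWS
    exact not_finite (⊥ : Subgroup (E ≃ᵃ[ℂ] E))
  rw [eq_top_iff, ← hspan]
  exact Submodule.span_mono Submodule.subset_span

end Lattice

/-! ### Root sets in Euclidean spaces -/

section EuclideanRoots

variable {U : Type*} [NormedAddCommGroup U] [InnerProductSpace ℝ U]

/-- A spanning set of nonzero vectors of a Euclidean space which is stable under its reflections,
crystallographic and reduced. -/
structure IsRootSet (Ψ : Set U) : Prop where
  span_eq_top : Submodule.span ℝ Ψ = ⊤
  ne_zero : ∀ a ∈ Ψ, a ≠ 0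
  exists_int : ∀ a ∈ Ψ, ∀ b ∈ Ψ, ∃ n : ℤ, 2 * ⟪a, b⟫_ℝ / ⟪a, a⟫_ℝ = n
  reflection_mem : ∀ a ∈ Ψ, ∀ b ∈ Ψ, b - (2 * ⟪a, b⟫_ℝ / ⟪a, a⟫_ℝ) • a ∈ Ψ
  reduced : ∀ a ∈ Ψ, ∀ c : ℝ, c • a ∈ Ψ → c = 1 ∨ c = -1

/-- By Cauchy–Schwarz the product of the two Cartan integers of a pair lies between $0$ and $4$, and
they vanish together. -/
lemma IsRootSet.abs_le_four {Ψ : Set U} (h : IsRootSet Ψ) {a b : U} (ha : a ∈ Ψ) (hb : b ∈ Ψ) :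
    ∃ n : ℤ, n ∈ Set.Icc (-4) 4 ∧ 2 * ⟪a, b⟫_ℝ / ⟪a, a⟫_ℝ = n := by
  obtain ⟨n, hn⟩ := h.exists_int a ha b hb
  obtain ⟨m, hm⟩ := h.exists_int b hb a ha
  refine ⟨n, ?_, hn⟩
  have ha0 : 0 < ⟪a, a⟫_ℝ := real_inner_self_pos.mpr (h.ne_zero a ha)
  have hb0 : 0 < ⟪b, b⟫_ℝ := real_inner_self_pos.mpr (h.ne_zero b hb)
  have hcs : ⟪a, b⟫_ℝ * ⟪a, b⟫_ℝ ≤ ⟪a, a⟫_ℝ * ⟪b, b⟫_ℝ := real_inner_mul_inner_self_le a b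
  have hmul : (n * m : ℝ) = 4 * (⟪a, b⟫_ℝ * ⟪a, b⟫_ℝ) / (⟪a, a⟫_ℝ * ⟪b, b⟫_ℝ) := by
    rw [← hn, ← hm, real_inner_comm a b]
    field_simp
    ring
  have h4 : (n * m : ℝ) ≤ 4 := by
    rw [hmul, div_le_iff₀ (mul_pos ha0 hb0)]
    linarith
  have h0 : (0 : ℝ) ≤ n * m := by
    rw [hmul]
    exact div_nonneg (mul_nonneg (by norm_num) (mul_self_nonneg _)) (mul_pos ha0 hb0).le
  have h4' : n * m ≤ 4 := by exact_mod_cast h4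
  have h0' : 0 ≤ n * m := by exact_mod_cast h0
  rcases eq_or_ne m 0 with hm0 | hm0
  · rw [hm0, Int.cast_zero, div_eq_zero_iff, real_inner_comm] at hm
    have : (n : ℝ) = 0 := by
      rw [← hn, div_eq_zero_iff]
      exact Or.inl (hm.resolve_right hb0.ne')
    have : n = 0 := by exact_mod_cast this
    rw [this]; norm_num
  · rcases lt_or_gt_of_ne hm0 with hm1 | hm1 <;> constructor <;> nlinarith

variable [FiniteDimensional ℝ U]

/-- A root is determined by its Cartan integers against a basis of roots, and these are bounded. -/
lemma IsRootSet.finite {Ψ : Set U} (h : IsRootSet Ψ) : Ψ.Finite := by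
  obtain ⟨B, hBΨ, hB, hli⟩ := exists_linearIndependent ℝ Ψ
  rw [h.span_eq_top] at hB
  have : Finite B := hli.setFinite
  let f : U → B → ℝ := fun a b => 2 * ⟪(b : U), a⟫_ℝ / ⟪(b : U), (b : U)⟫_ℝ
  refine Set.Finite.of_finite_image (f := f) ?_ fun a ha a' ha' haa' => ?_
  · refine (Set.Finite.pi' (t := fun _ => (Int.cast : ℤ → ℝ) '' Set.Icc (-4) 4)
      fun _ => (Set.finite_Icc _ _).image _).subset ?_
    rintro _ ⟨a, ha, rfl⟩ b
    obtain ⟨n, hn, hn'⟩ := h.abs_le_four (hBΨ b.2) ha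
    exact ⟨n, hn, hn'.symm⟩
  · have h1 : ∀ x ∈ Submodule.span ℝ B, ⟪x, a - a'⟫_ℝ = 0 := by
      intro x hx
      induction hx using Submodule.span_induction with
      | mem b hb =>
        have h2 := congrFun haa' ⟨b, hb⟩
        have hb0 : ⟪b, b⟫_ℝ ≠ 0 := inner_self_ne_zero.mpr (h.ne_zero b (hBΨ hb))
        simp only [f] at h2
        rw [div_left_inj' hb0, mul_right_inj' two_ne_zero] at h2
        rw [inner_sub_right, h2, sub_self]
      | zero => simp
      | add u v _ _ hu hv => rw [inner_add_left, hu, hv, add_zero]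
      | smul c v _ hv => rw [real_inner_smul_left, hv, mul_zero]
    exact sub_eq_zero.mp (inner_self_eq_zero.mp (h1 _ (hB ▸ trivial)))

instance isPerfPair_innerₗ : (innerₗ U).IsPerfPair := by
  have hinj : Function.Injective (innerₗ U) := by
    rw [injective_iff_map_eq_zero]
    intro x hx
    exact inner_self_eq_zero (𝕜 := ℝ).mp (congrArg (fun f => f x) hx)
  refine LinearMap.IsPerfPair.of_injective hinj ?_
  rw [flip_innerₗ]
  exact hinj

/-- The root pairing of a root set, with the elements of the root set as roots. -/
lemma IsRootSet.exists_rootPairing {Ψ : Set U} (h : IsRootSet Ψ) :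
    ∃ (ι : Type) (_ : Finite ι) (P : RootPairing ι ℝ U U), Set.range P.root = Ψ ∧
      P.toLinearMap = innerₗ U ∧
      (∀ i, P.coroot i = (2 / ⟪P.root i, P.root i⟫_ℝ) • P.root i) ∧ P.IsRootSystem ∧
      P.IsCrystallographic ∧ P.IsReduced := by
  have : Finite Ψ := h.finite.to_subtype
  obtain ⟨N, ⟨e⟩⟩ := Finite.exists_equiv_fin Ψ
  let root : Fin N ↪ U := e.symm.toEmbedding.trans (Function.Embedding.subtype _)
  have hroot (i : Fin N) : root i ∈ Ψ := (e.symm i).2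
  have hrange : Set.range root = Ψ := by
    ext x
    refine ⟨fun ⟨i, hi⟩ => hi ▸ hroot i, fun hx => ⟨e ⟨x, hx⟩, ?_⟩⟩
    change ((e.symm (e ⟨x, hx⟩) : Ψ) : U) = x
    rw [e.symm_apply_apply]
  have hne (i : Fin N) : ⟪root i, root i⟫_ℝ ≠ 0 := inner_self_ne_zero.mpr (h.ne_zero _ (hroot i))
  -- The map $a\mapsto 2a/\langle a\mid a\rangle$ is an involution, which makes the coroot map
  -- injective.
  have hinv (i : Fin N) : (2 / ⟪(2 / ⟪root i, root i⟫_ℝ) • root i,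
      (2 / ⟪root i, root i⟫_ℝ) • root i⟫_ℝ) • (2 / ⟪root i, root i⟫_ℝ) • root i = root i := by
    rw [smul_smul, real_inner_smul_left, real_inner_smul_right]
    conv_rhs => rw [← one_smul ℝ (root i)]
    congr 1
    have := hne i
    field_simp
  let coroot : Fin N ↪ U := ⟨fun i => (2 / ⟪root i, root i⟫_ℝ) • root i, fun i j hij => by
    simp only at hij
    apply root.injective
    rw [← hinv i, hij, hinv j]⟩
  have hcoroot (i : Fin N) : coroot i = (2 / ⟪root i, root i⟫_ℝ) • root i := rfl
  have hpair (x : U) (i : Fin N) :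
      innerₗ U x (coroot i) = 2 * ⟪root i, x⟫_ℝ / ⟪root i, root i⟫_ℝ := by
    rw [hcoroot, innerₗ_apply_apply, real_inner_smul_right, real_inner_comm (root i) x]
    ring
  have hp (i : Fin N) : innerₗ U (root i) (coroot i) = 2 := by
    rw [hpair, mul_div_assoc, div_self (hne i), mul_one]
  have hs (i : Fin N) : Set.MapsTo (Module.preReflection (root i) ((innerₗ U).flip (coroot i)))
      (Set.range root) (Set.range root) := by
    rw [hrange]
    intro x hx
    rw [Module.preReflection_apply, LinearMap.flip_apply, hpair]
    exact h.reflection_mem _ (hroot i) x hx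
  have hsp : Submodule.span ℝ (Set.range root) = ⊤ := by rw [hrange, h.span_eq_top]
  have hint (i j : Fin N) : ∃ z : ℤ, (z : ℝ) = innerₗ U (root i) (coroot j) := by
    obtain ⟨n, hn⟩ := h.exists_int _ (hroot j) _ (hroot i)
    exact ⟨n, by rw [hpair, hn]⟩
  refine ⟨Fin N, inferInstance, RootPairing.mk'' (innerₗ U) root coroot hp hs hsp, hrange, rfl,
    fun i => rfl, RootPairing.isRootSystem_mk'' hint, ⟨hint⟩, ⟨fun i j hij => ?_⟩⟩
  change root i = root j ∨ root i = -root j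
  change ¬ LinearIndependent ℝ ![root i, root j] at hij
  rw [LinearIndependent.pair_iff' (h.ne_zero _ (hroot i))] at hij
  push Not at hij
  obtain ⟨c, hc⟩ := hij
  rcases h.reduced _ (hroot i) c (hc ▸ hroot j) with rfl | rfl
  · left; rw [← hc, one_smul]
  · right; rw [← hc, neg_one_smul, neg_neg]

/-- The dual of the root system formed by a root set. -/
lemma IsRootSet.exists_isEuclideanRootSystem {Ψ : Set U} (h : IsRootSet Ψ) :
    ∃ (ι : Type) (_ : Finite ι) (R : RootPairing ι ℝ U U),
      IsEuclideanRootSystem R ∧ Set.range R.coroot = Ψ := by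
  obtain ⟨ι, hι, P, hrange, hlin, hco, hrs, hcr, hred⟩ := h.exists_rootPairing
  -- The elements of $\Psi$ must be coroots: $s_{\alpha,k}$ differs from $s_{\alpha,0}$ by the
  -- translation $k\alpha^\vee$, and the primitive roots are translations.
  refine ⟨ι, hι, P.flip, ⟨?_, fun i => ?_, inferInstance, inferInstance, inferInstance⟩, hrange⟩
  · change P.toLinearMap.flip = _
    rw [hlin, flip_innerₗ]
  · change P.root i = (2 / ⟪P.coroot i, P.coroot i⟫_ℝ) • P.coroot i
    have hne : ⟪P.root i, P.root i⟫_ℝ ≠ 0 :=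
      inner_self_ne_zero.mpr (h.ne_zero _ (hrange ▸ Set.mem_range_self i))
    rw [hco, smul_smul, real_inner_smul_left, real_inner_smul_right]
    conv_lhs => rw [← one_smul ℝ (P.root i)]
    congr 1
    field_simp

/-- A root set contains a system of simple roots: they have a dual family, and every root is
obtained from them by sign changes and simple reflections. -/
lemma IsRootSet.exists_simple {Ψ : Set U} (h : IsRootSet Ψ) :
    ∃ (κ : Type) (_ : Fintype κ) (s v : κ → U), (∀ i, s i ∈ Ψ) ∧
      (∀ i, ⟪s i, v i⟫_ℝ = 1) ∧ (∀ i j, i ≠ j → ⟪s i, v j⟫_ℝ = 0) ∧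
      ∀ p : U → Prop, (∀ a ∈ Ψ, p a → p (-a)) → (∀ i, p (s i)) →
        (∀ a ∈ Ψ, ∀ i, p a → p (a - (2 * ⟪s i, a⟫_ℝ / ⟪s i, s i⟫_ℝ) • s i)) → ∀ a ∈ Ψ, p a := by
  obtain ⟨ι, hι, P, hrange, hlin, hco, hrs, hcr, hred⟩ := h.exists_rootPairing
  obtain ⟨b⟩ := P.nonempty_base
  let B := b.toWeightBasis
  have hB (i : b.support) : B i = P.root i := b.toWeightBasis_apply i
  -- The basis dual to the simple roots, turned into vectors by the Riesz isomorphism.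
  let v : b.support → U := fun i =>
    (InnerProductSpace.toDual ℝ U).symm (LinearMap.toContinuousLinearMap (B.coord i))
  have hv (i j : b.support) : ⟪P.root i, v j⟫_ℝ = B.repr (B i) j := by
    rw [real_inner_comm, InnerProductSpace.toDual_symm_apply, hB]
    rfl
  refine ⟨b.support, inferInstance, fun i => P.root i, v, fun i => hrange ▸ Set.mem_range_self _,
    fun i => ?_, fun i j hij => ?_, fun p h0 h1 h2 a ha => ?_⟩
  · rw [hv, Module.Basis.repr_self, Finsupp.single_eq_same]
  · rw [hv, Module.Basis.repr_self, Finsupp.single_eq_of_ne hij.symm]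
  · rw [← hrange] at ha
    obtain ⟨i, rfl⟩ := ha
    have hmem (i : ι) : P.root i ∈ Ψ := hrange ▸ Set.mem_range_self _
    refine b.induction_reflect i (p := fun i => p (P.root i)) (fun i hi => ?_)
      (fun i hi => h1 ⟨i, hi⟩) (fun i j hi hj => ?_)
    · rw [P.root_reflectionPerm, P.reflection_apply_self]
      exact h0 _ (hmem i) hi
    · have h3 := h2 _ (hmem i) ⟨j, hj⟩ hi
      rw [← P.reflectionPerm_root, hlin, hco, innerₗ_apply_apply, real_inner_smul_right,
        real_inner_comm (P.root j) (P.root i)]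
      convert h3 using 3
      ring

end EuclideanRoots

/-! ### Real forms -/

section RealForm

variable {V : Type*} [NormedAddCommGroup V] [InnerProductSpace ℂ V]

/-- A real basis of $U$ is a complex basis of $V$: total reality separates real and imaginary parts
of a linear relation. -/
lemma isBaseChange_subtype [FiniteDimensional ℂ V] {U : Submodule ℝ V}
    (hU : ∀ x ∈ U, Complex.I • x ∈ U → x = 0) (htop : Submodule.span ℂ (U : Set V) = ⊤) :
    IsBaseChange ℂ U.subtype := by
  have : Module.Finite ℝ V := Module.Finite.trans ℂ V
  let b := Module.finBasis ℝ U
  have hli : LinearIndependent ℂ (fun i => (b i : V)) := by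
    rw [Fintype.linearIndependent_iff]
    intro c hc
    have h1 : ((∑ i, (c i).re • b i : U) : V) + Complex.I • ((∑ i, (c i).im • b i : U) : V) = 0 := by
      rw [← hc]
      push_cast
      rw [Finset.smul_sum, ← Finset.sum_add_distrib]
      refine Finset.sum_congr rfl fun i _ => ?_
      rw [smul_eq_re_add_im (c i), smul_comm Complex.I]
    have h2 : (∑ i, (c i).im • b i : U) = 0 := by
      refine Subtype.ext (hU _ (Subtype.property _) ?_)
      rw [← neg_eq_of_add_eq_zero_right h1]
      exact U.neg_mem (Subtype.property _)
    have h3 : (∑ i, (c i).re • b i : U) = 0 := by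
      rw [h2, Submodule.coe_zero, smul_zero, add_zero] at h1
      exact Subtype.ext h1
    intro i
    exact Complex.ext (Fintype.linearIndependent_iff.mp b.linearIndependent _ h3 i)
      (Fintype.linearIndependent_iff.mp b.linearIndependent _ h2 i)
  have hsp : ⊤ ≤ Submodule.span ℂ (Set.range fun i => (b i : V)) := by
    rw [← htop, Submodule.span_le]
    intro u hu
    have h1 : u = ∑ i, (b.repr ⟨u, hu⟩ i) • (b i : V) := by
      conv_lhs => rw [show u = ((⟨u, hu⟩ : U) : V) from rfl, ← b.sum_repr ⟨u, hu⟩]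
      push_cast
      rfl
    rw [h1]
    refine sum_mem fun i _ => ?_
    rw [← Complex.coe_smul]
    exact Submodule.smul_mem _ _ (Submodule.subset_span ⟨i, rfl⟩)
  let b' : Module.Basis _ ℂ V := Module.Basis.mk hli hsp
  have h := IsBaseChange.comp_equiv b.equivFun _ (IsBaseChange.of_fintype_basis ℝ b')
  convert h using 1
  ext u
  change (u : V) = Fintype.linearCombination ℝ b' (b.equivFun u)
  rw [Fintype.linearCombination_apply]
  conv_lhs => rw [← b.sum_repr u]
  push_cast
  refine Finset.sum_congr rfl fun i _ => ?_
  rw [Module.Basis.mk_apply]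
  rfl

lemma coe_real_inner {U : Submodule ℝ V} (h : ∀ x ∈ U, ∀ y ∈ U, (⟪x, y⟫_ℂ).im = 0) (x y : U) :
    ((⟪x, y⟫_ℝ : ℝ) : ℂ) = ⟪(x : V), (y : V)⟫_ℂ :=
  Complex.ext rfl (by rw [Complex.ofReal_im, h x x.2 y y.2])

lemma coe_real_inner_div {U : Submodule ℝ V} (h : ∀ x ∈ U, ∀ y ∈ U, (⟪x, y⟫_ℂ).im = 0)
    (a x : U) : ((2 * ⟪a, x⟫_ℝ / ⟪a, a⟫_ℝ : ℝ) : ℂ) =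
      2 * ⟪(a : V), (x : V)⟫_ℂ / ⟪(a : V), (a : V)⟫_ℂ := by
  rw [← coe_real_inner h, ← coe_real_inner h]
  push_cast
  rfl

lemma coe_rootReflection {U : Submodule ℝ V} (h : ∀ x ∈ U, ∀ y ∈ U, (⟪x, y⟫_ℂ).im = 0)
    (a x : U) :
    ((x - (2 * ⟪a, x⟫_ℝ / ⟪a, a⟫_ℝ) • a : U) : V) = rootReflection (a : V) (x : V) := by
  rw [rootReflection, ← coe_real_inner_div h, Complex.coe_smul]
  rfl

lemma rootReflection_rootReflection {a : V} (ha : a ≠ 0) (v : V) :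
    rootReflection a (rootReflection a v) = v := by
  have h0 := inner_self_ne_zero' ha
  unfold rootReflection
  rw [inner_sub_right, inner_smul_right, sub_sub, ← add_smul]
  have h : 2 * ⟪a, v⟫_ℂ / ⟪a, a⟫_ℂ +
      2 * (⟪a, v⟫_ℂ - 2 * ⟪a, v⟫_ℂ / ⟪a, a⟫_ℂ * ⟪a, a⟫_ℂ) / ⟪a, a⟫_ℂ = 0 := by
    field_simp
    ring
  rw [h, zero_smul, sub_zero]

end RealForm

/-! ### The root set of primitive roots and the special point -/

section SpecialPoint

variable {V : Type*} [NormedAddCommGroup V] [InnerProductSpace ℂ V]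
  {E : Type*} [MetricSpace E] [NormedAddTorsor V E]

/-- The primitive roots form a root set in the real span of the translations. -/
lemma isRootSet_isPrimitiveRoot {W : Subgroup (E ≃ᵃ[ℂ] E)} (hiso : ∀ γ ∈ W, Isometry γ)
    {U : Submodule ℝ V} (hUW : U = translationSpan W)
    (hU : ∀ x ∈ translationSpan W, Complex.I • x ∈ translationSpan W → x = 0)
    (hspan : Submodule.span ℝ {a | IsPrimitiveRoot W a} = translationSpan W) :
    IsRootSet {a : U | IsPrimitiveRoot W (a : V)} := by
  subst hUW
  have him : ∀ x ∈ translationSpan W, ∀ y ∈ translationSpan W, (⟪x, y⟫_ℂ).im = 0 :=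
    fun x hx y hy => inner_im_eq_zero hU hspan hx hy
  refine ⟨?_, fun a ha h => ha.ne_zero (congrArg Subtype.val h), fun a ha b hb => ?_,
    fun a ha b hb => ?_, fun a ha c hc => ?_⟩
  · apply Submodule.map_injective_of_injective (translationSpan W).injective_subtype
    rw [Submodule.map_span, Submodule.map_subtype_top]
    refine Eq.trans (congrArg _ ?_) hspan
    ext a
    refine ⟨fun ⟨x, hx, hxa⟩ => hxa ▸ hx, fun ha => ?_⟩
    have ha' : IsPrimitiveRoot W a := ha
    have hm : a ∈ translationSpan W := translations_subset_span ha'.mem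
    exact ⟨⟨a, hm⟩, ha', rfl⟩
  · obtain ⟨n, hn⟩ := ha.exists_int hU hb.mem
    refine ⟨n, ?_⟩
    rw [← coe_real_inner_div him] at hn
    exact_mod_cast hn
  · obtain ⟨γ, hγ, -, h⟩ := ha.exists_reflection
    change IsPrimitiveRoot W _
    rw [coe_rootReflection him, ← h]
    exact hb.map hiso hγ
  · change IsPrimitiveRoot W ((c • a : translationSpan W) : V) at hc
    have hca : ((c • a : translationSpan W) : V) = c • (a : V) := rfl
    rw [hca] at hc
    obtain ⟨n, hn⟩ := ha.primitive c hc.mem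
    have hc0 : c ≠ 0 := by
      rintro rfl
      exact hc.ne_zero (zero_smul _ _)
    -- Primitivity of both $a$ and $ca$ makes $c$ and $c^{-1}$ integers.
    obtain ⟨m, hm⟩ := hc.primitive c⁻¹ (by rw [smul_smul, inv_mul_cancel₀ hc0, one_smul]; exact ha.mem)
    have hnm : (n * m : ℝ) = 1 := by rw [← hn, ← hm, mul_inv_cancel₀ hc0]
    have hnm' : n * m = 1 := by exact_mod_cast hnm
    rcases Int.isUnit_iff.mp (IsUnit.of_mul_eq_one m hnm') with h | h
    · left; rw [hn, h]; simp
    · right; rw [hn, h]; simp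

variable [FiniteDimensional ℂ V]

/-- There is a special point: every primitive root is the root of a reflection of `W` fixing it. -/
lemma exists_special_point {W : Subgroup (E ≃ᵃ[ℂ] E)} (hiso : ∀ γ ∈ W, Isometry γ)
    (hU : ∀ x ∈ translationSpan W, Complex.I • x ∈ translationSpan W → x = 0)
    (hspan : Submodule.span ℝ {a | IsPrimitiveRoot W a} = translationSpan W) :
    ∃ p : E, ∀ a : V, IsPrimitiveRoot W a →
      ∃ γ ∈ W, γ p = p ∧ ∀ v, γ.linear v = rootReflection a v := by
  have : Module.Finite ℝ V := Module.Finite.trans ℂ V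
  have him : ∀ x ∈ translationSpan W, ∀ y ∈ translationSpan W, (⟪x, y⟫_ℂ).im = 0 :=
    fun x hx y hy => inner_im_eq_zero hU hspan hx hy
  have hΨ := isRootSet_isPrimitiveRoot hiso rfl hU hspan
  obtain ⟨κ, _, s, v, hs, hsv, hsv', hind⟩ := hΨ.exists_simple
  choose g hgW hg hglin using fun i => (hs i).exists_reflection
  choose q hq using hg
  obtain ⟨o⟩ : Nonempty E := inferInstance
  -- The coefficients solve $\langle s_j\mid p-o\rangle=\langle s_j\mid q_j-o\rangle$ in the dual
  -- basis, placing $p$ on the mirror of every simple reflection $g_j$.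
  let c : κ → ℂ := fun j => ⟪(s j : V), q j -ᵥ o⟫_ℂ
  let p : E := (∑ j, c j • (v j : V)) +ᵥ o
  have hgp (i : κ) : g i p = p := by
    have h1 : ⟪(s i : V), ∑ j, c j • (v j : V)⟫_ℂ = c i := by
      rw [inner_sum, Finset.sum_eq_single i]
      · rw [inner_smul_right, ← coe_real_inner him, hsv, Complex.ofReal_one, mul_one]
      · intro j _ hj
        rw [inner_smul_right, ← coe_real_inner him, hsv' i j hj.symm, Complex.ofReal_zero, mul_zero]
      · exact fun h => absurd (Finset.mem_univ i) h
    have h2 : ⟪(s i : V), p -ᵥ q i⟫_ℂ = 0 := by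
      rw [← vsub_sub_vsub_cancel_right p (q i) o, inner_sub_right, vadd_vsub, h1, sub_self]
    rw [← vsub_vadd p (q i), map_vadd_linear, hglin, hq, rootReflection, h2]
    simp
  refine ⟨p, fun a ha => ?_⟩
  -- Conjugating by the $g_i$, all of which fix $p$, reaches the reflections of all roots.
  refine hind (fun a => ∃ γ ∈ W, γ p = p ∧ ∀ v, γ.linear v = rootReflection (a : V) v)
    (fun a _ ⟨γ, hγ, hγp, h⟩ => ⟨γ, hγ, hγp, fun v => ?_⟩) (fun i => ⟨g i, hgW i, hgp i, hglin i⟩)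
    (fun a _ i ⟨γ, hγ, hγp, h⟩ => ?_) ⟨a, translations_subset_span ha.mem⟩ ha
  · rw [h, Submodule.coe_neg, ← neg_one_smul ℂ (a : V), rootReflection_smul (by norm_num)]
  · refine ⟨g i * γ * (g i)⁻¹, W.mul_mem (W.mul_mem (hgW i) hγ) (W.inv_mem (hgW i)), ?_,
      fun v => ?_⟩
    · have h1 : (g i)⁻¹ p = p := by
        conv_lhs => rw [← hgp i]
        exact inv_apply_self' _ _
      change g i (γ ((g i)⁻¹ p)) = p
      rw [h1, hγp, hgp]
    · rw [conj_linear (hiso _ (hgW i)) h, coe_rootReflection him, hglin]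

end SpecialPoint

/-! ### Identification with an affine Weyl group -/

section AffineWeyl

variable {U : Type*} [NormedAddCommGroup U] [InnerProductSpace ℝ U]
  {Q : Type*} [MetricSpace Q] [NormedAddTorsor U Q]

/-- The affine reflection `s_{α,k}` exists as an affine transformation. -/
lemma exists_isAffineRootReflection {ι : Type*} {R : RootPairing ι ℝ U U}
    (hR : R.toLinearMap = innerₗ U) (o : Q) (i : ι) (k : ℤ) :
    ∃ γ : Q ≃ᵃ[ℝ] Q, IsAffineRootReflection R o i k γ := by
  refine ⟨(AffineEquiv.vaddConst ℝ o).symm.trans ((R.coreflection i).toAffineEquiv.trans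
    (AffineEquiv.vaddConst ℝ ((k : ℝ) • R.coroot i +ᵥ o))), fun x => ?_⟩
  change R.coreflection i (x -ᵥ o) +ᵥ ((k : ℝ) • R.coroot i +ᵥ o) = _
  have h : R.root' i (x -ᵥ o) = ⟪R.root i, x -ᵥ o⟫_ℝ := by
    rw [RootPairing.root', hR, innerₗ_apply_apply]
  rw [R.coreflection_apply, h, vadd_vadd]
  conv_rhs => rw [← vsub_vadd x o, vadd_vadd]
  rw [vsub_vadd]
  congr 1
  module

/-- Expresses the reflection through its coroot, which will be the primitive root. -/
lemma inner_root_eq {ι : Type*} {R : RootPairing ι ℝ U U} (hR : IsEuclideanRootSystem R) (i : ι)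
    (x : U) : ⟪R.root i, x⟫_ℝ = 2 * ⟪R.coroot i, x⟫_ℝ / ⟪R.coroot i, R.coroot i⟫_ℝ := by
  have h : ⟪R.root i, R.root i⟫_ℝ ≠ 0 := inner_self_ne_zero.mpr (R.ne_zero i)
  rw [hR.coroot_eq, real_inner_smul_left, real_inner_smul_left, real_inner_smul_right]
  field_simp

end AffineWeyl

section Crystallographic

variable {V : Type*} [NormedAddCommGroup V] [InnerProductSpace ℂ V] [FiniteDimensional ℂ V]
  {E : Type*} [MetricSpace E] [NormedAddTorsor V E]

/-- A discrete reflection group with totally real translation lattice and irreducible linear part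
has an irreducible root system of primitive roots. -/
lemma isIrreducible_rootPairing {W : Subgroup (E ≃ᵃ[ℂ] E)} (hW : IsRGroup W)
    (hirr : ∀ D : Submodule ℂ V, (∀ γ ∈ W, ∀ v ∈ D, γ.linear v ∈ D) → D = ⊥ ∨ D = ⊤)
    (hT : ∃ v ∈ translations W, v ≠ (0 : V))
    (hU : ∀ x ∈ translationSpan W, Complex.I • x ∈ translationSpan W → x = 0)
    (htop : Submodule.span ℂ (translations W : Set V) = ⊤)
    (him : ∀ x ∈ translationSpan W, ∀ y ∈ translationSpan W, (⟪x, y⟫_ℂ).im = 0)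
    {U : Submodule ℝ V} (hUW : U = translationSpan W) {ι : Type} (R : RootPairing ι ℝ U U)
    (hR : IsEuclideanRootSystem R)
    (hrange : Set.range R.coroot = {a : U | IsPrimitiveRoot W (a : V)}) : R.IsIrreducible := by
  subst hUW
  have hnt : Nontrivial (translationSpan W) := by
    obtain ⟨v, hv, hv0⟩ := hT
    exact ⟨⟨v, translations_subset_span hv⟩, 0, fun h => hv0 (congrArg Subtype.val h)⟩
  refine RootPairing.IsIrreducible.mk' R fun q hq hq0 => ?_
  have hrefl (i : ι) (x : translationSpan W) :
      (R.reflection i x : V) = rootReflection (R.coroot i : V) (x : V) := by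
    have hne : ⟪R.root i, R.root i⟫_ℝ ≠ 0 := inner_self_ne_zero.mpr (R.ne_zero i)
    rw [← coe_rootReflection him]
    congr 1
    have h1 : R.coroot' i x = ⟪x, R.coroot i⟫_ℝ := by
      change R.toLinearMap x (R.coroot i) = _
      rw [hR.toLinearMap_eq, innerₗ_apply_apply]
    rw [R.reflection_apply, h1, ← inner_root_eq hR, hR.coroot_eq, real_inner_smul_right, smul_smul,
      real_inner_comm (R.root i) x]
    congr 2
    ring
  obtain ⟨S, hS, hWS⟩ := hW.generated
  let q' : Submodule ℝ V := q.map (translationSpan W).subtype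
  have hq'U : q' ≤ translationSpan W := Submodule.map_subtype_le _ _
  have hgen (γ : E ≃ᵃ[ℂ] E) (hγ : γ ∈ S) :
      (∀ x ∈ q', γ.linear x ∈ q') ∧ ∀ v, γ.linear (γ.linear v) = v := by
    obtain ⟨a, ha, h⟩ := (hS γ hγ).exists_isPrimitiveRoot hW.discrete (fun _ => hW.isometry) hU
      htop (hWS ▸ Subgroup.subset_closure hγ)
    refine ⟨?_, fun v => by rw [h, h, rootReflection_rootReflection ha.ne_zero]⟩
    rintro _ ⟨x, hx, rfl⟩
    have haU : (⟨a, translations_subset_span ha.mem⟩ : translationSpan W) ∈ Set.range R.coroot := by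
      rw [hrange]; exact ha
    obtain ⟨i, hi⟩ := haU
    refine ⟨R.reflection i x, hq i hx, ?_⟩
    change (R.reflection i x : V) = _
    rw [hrefl, hi, h]
    rfl
  have hinv (γ : E ≃ᵃ[ℂ] E) (hγ : γ ∈ W) :
      ∀ x ∈ q', γ.linear x ∈ q' ∧ γ⁻¹.linear x ∈ q' := by
    rw [hWS] at hγ
    induction hγ using Subgroup.closure_induction with
    | mem γ hγ =>
      refine fun x hx => ⟨(hgen γ hγ).1 x hx, ?_⟩
      rw [← (hgen γ hγ).2 x, linear_inv_apply]
      exact (hgen γ hγ).1 x hx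
    | one => exact fun x hx => ⟨hx, by rw [inv_one]; exact hx⟩
    | mul γ δ _ _ hγ hδ =>
      refine fun x hx => ⟨(hγ _ (hδ x hx).1).1, ?_⟩
      rw [mul_inv_rev]
      exact (hδ _ (hγ x hx).2).2
    | inv γ _ hγ => exact fun x hx => ⟨(hγ x hx).2, by rw [inv_inv]; exact (hγ x hx).1⟩
  -- The complex span of $q$ is invariant under $W$. If it is $V$, total reality of $U$ forces
  -- $q=U$.
  rcases hirr (Submodule.span ℂ (q' : Set V)) fun γ hγ v hv => by
    induction hv using Submodule.span_induction with
    | mem x hx => exact Submodule.subset_span (hinv γ hγ x hx).1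
    | zero => rw [map_zero]; exact zero_mem _
    | add u v _ _ hu hv => rw [map_add]; exact add_mem hu hv
    | smul c v _ hv => rw [map_smul]; exact Submodule.smul_mem _ _ hv
    with h | h
  · refine absurd ?_ hq0
    rw [Submodule.eq_bot_iff]
    intro x hx
    have : (x : V) ∈ Submodule.span ℂ (q' : Set V) := Submodule.subset_span ⟨x, hx, rfl⟩
    rw [h, Submodule.mem_bot] at this
    exact Subtype.ext this
  · have h1 := eq_of_le_of_span_complex hU hq'U h
    rw [eq_top_iff]
    intro x _
    obtain ⟨y, hy, hyx⟩ : (x : V) ∈ q' := by rw [h1]; exact x.2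
    rwa [← Subtype.ext hyx]

/-- A discrete irreducible reflection group with totally real translation lattice is the
complexification of an affine Weyl group. -/
lemma exists_isIrreducibleAffineWeylGroup {W : Subgroup (E ≃ᵃ[ℂ] E)} (hW : IsRGroup W)
    (hirr : ∀ D : Submodule ℂ V, (∀ γ ∈ W, ∀ v ∈ D, γ.linear v ∈ D) → D = ⊥ ∨ D = ⊤)
    (hT : ∃ v ∈ translations W, v ≠ (0 : V))
    (hU : ∀ x ∈ translationSpan W, Complex.I • x ∈ translationSpan W → x = 0)
    (hspan : Submodule.span ℝ {a | IsPrimitiveRoot W a} = translationSpan W) :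
    ∃ (F : AffineSubspace ℝ E) (_ : Nonempty F) (G : Subgroup (F ≃ᵃ[ℝ] F)),
      IsRealForm F.direction ∧ IsIrreducibleAffineWeylGroup G ∧
        W = complexification F G := by
  have : Module.Finite ℝ V := Module.Finite.trans ℂ V
  have hiso : ∀ γ ∈ W, Isometry γ := fun γ hγ => hW.isometry hγ
  have htop := span_translations_eq_top hirr hT
  have him : ∀ x ∈ translationSpan W, ∀ y ∈ translationSpan W, (⟪x, y⟫_ℂ).im = 0 :=
    fun x hx y hy => inner_im_eq_zero hU hspan hx hy
  have hUtop : Submodule.span ℂ (translationSpan W : Set V) = ⊤ :=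
    top_le_iff.mp (htop ▸ Submodule.span_mono fun v hv => translations_subset_span hv)
  obtain ⟨p, hp⟩ := exists_special_point hiso hU hspan
  let F : AffineSubspace ℝ E := AffineSubspace.mk' p (translationSpan W)
  have hF : F.direction = translationSpan W := AffineSubspace.direction_mk' _ _
  let o : F := ⟨p, AffineSubspace.self_mem_mk' _ _⟩
  have hne : Nonempty F := ⟨o⟩
  obtain ⟨ι, hι, R, hR, hrange⟩ :=
    (isRootSet_isPrimitiveRoot hiso hF hU hspan).exists_isEuclideanRootSystem
  have hRirr := isIrreducible_rootPairing hW hirr hT hU htop him hF R hR hrange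
  have himF : ∀ x ∈ F.direction, ∀ y ∈ F.direction, (⟪x, y⟫_ℂ).im = 0 := by rwa [hF]
  have hcoroot (i : ι) : IsPrimitiveRoot W (R.coroot i : V) := by
    have : R.coroot i ∈ {a : F.direction | IsPrimitiveRoot W (a : V)} := hrange ▸ Set.mem_range_self i
    exact this
  -- the affine root reflections, written out in `E`
  have happly (i : ι) (k : ℤ) (γ : F ≃ᵃ[ℝ] F) (hγ : IsAffineRootReflection R o i k γ) (x : F) :
      ((γ x : F) : E) =
        ((k : ℝ) • (R.coroot i : V) + rootReflection (R.coroot i : V) ((x : E) -ᵥ p)) +ᵥ p := by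
    rw [hγ x, inner_root_eq hR, AffineSubspace.coe_vadd]
    have h1 := coe_rootReflection himF (R.coroot i) (x -ᵥ o)
    rw [AffineSubspace.coe_vsub] at h1
    change _ = rootReflection (R.coroot i : V) ((x : E) -ᵥ p) at h1
    rw [← h1]
    conv_lhs => rw [← vsub_vadd (x : E) p, vadd_vadd]
    congr 1
    push_cast
    change _ = (k : ℝ) • (R.coroot i : V) + (((x : E) -ᵥ p) - _)
    rw [sub_smul]
    abel
  refine ⟨F, hne, affineWeylGroup R o, ⟨?_, himF⟩, ⟨ι, hι, R, o, hR, hRirr, rfl⟩, ?_⟩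
  · exact isBaseChange_subtype (by rwa [hF]) (by rwa [hF])
  apply le_antisymm
  · obtain ⟨S, hS, hWS⟩ := hW.generated
    conv_lhs => rw [hWS]
    rw [Subgroup.closure_le]
    intro γ hγ
    have hγW : γ ∈ W := hWS ▸ Subgroup.subset_closure hγ
    obtain ⟨a, ha, h⟩ := (hS γ hγ).exists_isPrimitiveRoot hW.discrete hiso hU htop hγW
    obtain ⟨q, -, hq, -⟩ := (hS γ hγ).exists_root
    obtain ⟨g, hgW, hgp, hg⟩ := hp a ha
    have hgp' : g⁻¹ p = p := by
      conv_lhs => rw [← hgp]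
      exact inv_apply_self' _ _
    -- The reflection $g$ at $p$ has the same linear part as $\gamma$, so they differ by a
    -- translation along $a$. Primitivity makes it $na$, whence $\gamma$ extends $s_{\alpha,n}$.
    have ht : γ p -ᵥ p ∈ translations W := by
      have h1 := vsub_mem_translations (W := W) (γ := γ * g⁻¹) (W.mul_mem hγW (W.inv_mem hgW))
        (fun v => by rw [linear_mul, h, ← hg, linear_apply_inv]) p
      change γ (g⁻¹ p) -ᵥ p ∈ _ at h1
      rwa [hgp'] at h1
    have hta : γ p -ᵥ p = (-(2 * ⟪a, p -ᵥ q⟫_ℂ / ⟪a, a⟫_ℂ)) • a := by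
      have h1 := linear_vsub γ p q
      rw [h, hq, rootReflection] at h1
      rw [← vsub_sub_vsub_cancel_right (γ p) p q, ← h1, neg_smul]
      abel
    rw [hta] at ht
    have h2 := im_eq_zero_of_smul_mem hU (translations_subset_span ha.mem) ha.ne_zero
      (translations_subset_span ht)
    rw [smul_eq_re_add_im, h2, zero_smul, add_zero] at ht
    obtain ⟨n, hn⟩ := ha.primitive _ ht
    rw [smul_eq_re_add_im, h2, zero_smul, add_zero, hn] at hta
    have haF : (⟨a, hF ▸ translations_subset_span ha.mem⟩ : F.direction) ∈ Set.range R.coroot := by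
      rw [hrange]; exact ha
    obtain ⟨i, hi⟩ := haF
    obtain ⟨δ, hδ⟩ := exists_isAffineRootReflection hR.toLinearMap_eq o i n
    refine ⟨hiso γ hγW, δ, Subgroup.subset_closure ⟨i, n, hδ⟩, fun x => ?_⟩
    rw [happly i n δ hδ x, hi]
    conv_lhs => rw [← vsub_vadd (x : E) p, map_vadd_linear, ← vsub_vadd (γ p) p, hta, h, vadd_vadd]
    rw [add_comm]
  · rintro γ' ⟨-, g, hg, hγ'⟩
    have hext : ∃ w ∈ W, ∀ x : F, w (x : E) = ((g x : F) : E) := by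
      clear hγ'
      induction hg using Subgroup.closure_induction with
      | mem γ hγ =>
        obtain ⟨i, k, hγ⟩ := hγ
        obtain ⟨g, hgW, hgp, hg⟩ := hp _ (hcoroot i)
        -- On $F$, $s_{\alpha,k}$ is the reflection of $W$ at $p$ followed by the translation
        -- $k\alpha^\vee$, which lies in $W$ as the coroot is a primitive root.
        refine ⟨AffineEquiv.constVAdd ℂ E ((k : ℝ) • (R.coroot i : V)) * g, W.mul_mem ?_ hgW,
          fun x => ?_⟩
        · rw [← mem_translations, Int.cast_smul_eq_zsmul]
          exact zsmul_mem (hcoroot i).mem _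
        · rw [happly i k γ hγ x]
          change (k : ℝ) • (R.coroot i : V) +ᵥ g (x : E) = _
          conv_lhs => rw [← vsub_vadd (x : E) p, map_vadd_linear, hg, hgp, vadd_vadd]
      | one => exact ⟨1, W.one_mem, fun _ => rfl⟩
      | mul a b _ _ ha hb =>
        obtain ⟨w, hw, h⟩ := ha
        obtain ⟨w', hw', h'⟩ := hb
        refine ⟨w * w', W.mul_mem hw hw', fun x => ?_⟩
        change w (w' x) = ((a (b x) : F) : E)
        rw [h', h]
      | inv a _ ha =>
        obtain ⟨w, hw, h⟩ := ha
        refine ⟨w⁻¹, W.inv_mem hw, fun x => ?_⟩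
        obtain ⟨y, rfl⟩ := a.surjective x
        change w⁻¹ ((a y : F) : E) = ((a.symm (a y) : F) : E)
        rw [a.symm_apply_apply, ← h, inv_apply_self']
    obtain ⟨w, hw, hwg⟩ := hext
    have heq (x : F) : γ' x = w x := by rw [hγ', hwg]
    suffices γ' = w by rwa [this]
    -- Two complex affine maps agreeing on $F$ coincide, because the direction of $F$ spans $V$ over
    -- $\mathbb C$.
    refine eq_of_linear_eq_of_apply_eq (fun v => ?_) p (heq o)
    have hv : v ∈ Submodule.span ℂ (translationSpan W : Set V) := hUtop ▸ trivial
    induction hv using Submodule.span_induction with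
    | mem u hu =>
      have h1 := heq ⟨u +ᵥ p, AffineSubspace.vadd_mem_mk' _ hu⟩
      have h2 : γ' p = w p := heq o
      change γ' (u +ᵥ p) = w (u +ᵥ p) at h1
      rw [map_vadd_linear, map_vadd_linear, h2] at h1
      exact vadd_right_cancel _ h1
    | zero => rw [map_zero, map_zero]
    | add u v _ _ hu hv => rw [map_add, map_add, hu, hv]
    | smul c v _ hv => rw [map_smul, map_smul, hv]

end Crystallographic

/-! ### Complexifications are noncrystallographic -/

section Noncompact

variable {V : Type*} [NormedAddCommGroup V] [InnerProductSpace ℂ V]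
  {E : Type*} [MetricSpace E] [NormedAddTorsor V E]

/-- An element of the complexification is an isometry mapping $F$ onto itself. -/
lemma infDist_complexification {F : AffineSubspace ℝ E} [Nonempty F] {G : Subgroup (F ≃ᵃ[ℝ] F)}
    {γ : E ≃ᵃ[ℂ] E} (hγ : γ ∈ complexification F G) (x : E) :
    Metric.infDist (γ x) F = Metric.infDist x F := by
  obtain ⟨hiso, g, -, hg⟩ := hγ
  have himg : γ '' (F : Set E) = F := by
    ext y
    constructor
    · rintro ⟨z, hz, rfl⟩
      rw [hg ⟨z, hz⟩]
      exact (g ⟨z, hz⟩).2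
    · intro hy
      refine ⟨g.symm ⟨y, hy⟩, (g.symm ⟨y, hy⟩).2, ?_⟩
      rw [hg, g.apply_symm_apply]
  conv_lhs => rw [← himg]
  exact Metric.infDist_image hiso

/-- For $w$ in the direction of $F$, $\langle u\mid w\rangle$ is real, so $\langle u\mid
itu-w\rangle$ has imaginary part $t\|u\|^2$; Cauchy–Schwarz bounds $\|itu-w\|$ from below. -/
lemma le_infDist_of_isRealForm {F : AffineSubspace ℝ E}
    (hF : IsRealForm F.direction) {p : E} (hp : p ∈ F) {u : V} (hu : u ∈ F.direction) (t : ℝ) :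
    t * ‖u‖ ≤ Metric.infDist (((t * Complex.I : ℂ) • u) +ᵥ p) F := by
  rcases eq_or_ne u 0 with rfl | hu0
  · simpa using Metric.infDist_nonneg
  refine (Metric.le_infDist ⟨p, hp⟩).mpr fun {z} hz => ?_
  have hw := F.vsub_mem_direction hz hp
  rw [dist_eq_norm_vsub V, ← vsub_sub_vsub_cancel_right _ z p, vadd_vsub]
  have h1 : (⟪u, ((t * Complex.I : ℂ) • u) - (z -ᵥ p)⟫_ℂ).im = t * ‖u‖ ^ 2 := by
    rw [inner_sub_right, Complex.sub_im, hF.inner_im u hu _ hw, inner_smul_right,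
      inner_self_eq_norm_sq_to_K]
    simp [← Complex.ofReal_pow]
  have h2 := (le_abs_self _).trans ((Complex.abs_im_le_norm
    ⟪u, ((t * Complex.I : ℂ) • u) - (z -ᵥ p)⟫_ℂ).trans (norm_inner_le_norm _ _))
  rw [h1] at h2
  have h3 := norm_pos_iff.mpr hu0
  refine le_of_mul_le_mul_left ?_ h3
  linarith

/-- The complexification of a group acting on a real form does not act cocompactly. -/
lemma isNoncrystallographic_of_equivalent [FiniteDimensional ℂ V] {W : Subgroup (E ≃ᵃ[ℂ] E)}
    (hinf : Infinite W) {F : AffineSubspace ℝ E} [Nonempty F] {G : Subgroup (F ≃ᵃ[ℝ] F)}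
    (hF : IsRealForm F.direction) (h : Equivalent W (complexification F G)) :
    IsNoncrystallographic W := by
  obtain ⟨φ, hφ⟩ := h
  -- A zero direction would give $V=0$ and a trivial affine group, contrary to $W$ being infinite.
  obtain ⟨u, hu, hu0⟩ : ∃ u ∈ F.direction, u ≠ 0 := by
    by_contra! hcon
    have hV : Subsingleton V := by
      refine subsingleton_of_forall_eq 0 fun x => ?_
      induction x using hF.isBaseChange.inductionOn with
      | zero => rfl
      | tmul m => exact hcon m m.2
      | smul s n hn => rw [hn, smul_zero]
      | add a b ha hb => rw [ha, hb, add_zero]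
    have hE : Subsingleton E := ⟨fun x y => vsub_eq_zero_iff_eq.mp (Subsingleton.elim _ _)⟩
    have : Subsingleton (E ≃ᵃ[ℂ] E) := ⟨fun f g => AffineEquiv.ext fun x => Subsingleton.elim _ _⟩
    exact not_finite W
  have hmem (γ : E ≃ᵃ[ℂ] E) (hγ : γ ∈ W) : (φ.symm.trans γ).trans φ ∈ complexification F G := by
    rw [← SetLike.mem_coe, hφ]
    exact ⟨γ, hγ, rfl⟩
  let f : Quotient (orbitSetoid W) → ℝ := Quotient.lift (fun x => Metric.infDist (φ x) F) (by
    rintro x _ ⟨γ, hγ, rfl⟩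
    have h1 := infDist_complexification (hmem γ hγ) (φ x)
    change Metric.infDist (φ (γ (φ.symm (φ x)))) F = _ at h1
    rw [φ.symm_apply_apply] at h1
    exact h1.symm)
  have hφc : Continuous φ := φ.toAffineMap.continuous_of_finiteDimensional
  have hf : Continuous f := ((Metric.continuous_infDist_pt _).comp hφc).quotient_lift _
  intro hcomp
  obtain ⟨C, hC⟩ := (isCompact_range hf).bddAbove
  obtain ⟨p⟩ := ‹Nonempty F›
  have hu' := norm_pos_iff.mpr hu0
  -- This parameter gives a point at distance at least $C+1$ from $F$.
  have h1 := le_infDist_of_isRealForm hF p.2 hu ((C + 1) / ‖u‖)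
  rw [div_mul_cancel₀ _ hu'.ne'] at h1
  have h2 := hC ⟨⟦φ.symm (((((C + 1) / ‖u‖ : ℝ) * Complex.I : ℂ) • u) +ᵥ (p : E))⟧, rfl⟩
  change Metric.infDist (φ (φ.symm _)) F ≤ C at h2
  rw [φ.apply_symm_apply] at h2
  linarith

end Noncompact

end ReflGroup

open ReflGroup in
/-- An infinite irreducible complex `r`-group is noncrystallographic if and only if it is equivalent
to the complexification of an irreducible affine Weyl group. -/
theorem theorem2p2p1
    {V : Type*} [NormedAddCommGroup V] [InnerProductSpace ℂ V] [FiniteDimensional ℂ V]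
    {E : Type*} [MetricSpace E] [NormedAddTorsor V E]
    (W : Subgroup (E ≃ᵃ[ℂ] E))
    (hW : IsRGroup W) (hinf : Infinite W) (hirr : ReflGroup.IsIrreducible W) :
    IsNoncrystallographic W ↔
      ∃ (F : AffineSubspace ℝ E) (_ : Nonempty F) (G : Subgroup (F ≃ᵃ[ℝ] F)),
        IsRealForm F.direction ∧ IsIrreducibleAffineWeylGroup G ∧
          Equivalent W (complexification F G) := by
  have hiso : ∀ γ ∈ W, Isometry γ := fun γ hγ => hW.isometry hγ
  have hirr' := hW.eq_bot_or_eq_top hirr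
  constructor
  · intro hnc
    have hT := hW.discrete.exists_translation_ne_zero hiso hinf hirr'
    have hU := eq_zero_of_I_smul_mem hirr' hnc
    have hspan := span_isPrimitiveRoot hW hinf hirr' hU (span_translations_eq_top hirr' hT)
    obtain ⟨F, hne, G, hF, hG, h⟩ := exists_isIrreducibleAffineWeylGroup hW hirr' hT hU hspan
    refine ⟨F, hne, G, hF, hG, AffineEquiv.refl ℂ E, ?_⟩
    rw [← h]
    exact (Set.image_id' _).symm
  · rintro ⟨F, hne, G, hF, -, h⟩
    exact isNoncrystallographic_of_equivalent hinf hF h
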